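/- **Setting.** Let $C=(C_{i,j})_{i,j\in I}$ be a symmetrizable generalized Cartan matrix ($I$ finite, $n=|I|$, $l=\operatorname{rank} C$) with integers $r_i\ge 1$ such that $B=DC$, $D=\mathrm{diag}(r_i)$, is symmetric. Let $(\mathfrak h,\{\alpha_i\},\{\alpha_i^\vee\})$ be a realization of $C$ over $\mathbb Q$ ($\dim\mathfrak h=2n-l$, $\alpha_j(\alpha_i^\vee)=C_{i,j}$), with a symmetric bilinear form on $\mathfrak h^*$ such that $(\alpha_i,\mu)=\mu(r_i\alpha_i^\vee)$, and let $\nu:\mathfrak h^*\to\mathfrak h$ be given by $\mu(\nu(\lambda))=(\lambda,\mu)$. Let $q\in\mathbb C^*$ be not a root of unity, with a fixed logarithm, so that $q^x$ makes sense for $x\in\mathbb Q$; put $q_i=q^{r_i}$, $[m]_z=\frac{z^m-z^{-m}}{z-z^{-1}}$, $C_{i,i}(z)=z^{r_i}+z^{-r_i}$, $C_{i,j}(z)=[C_{i,j}]_z$ ($i\ne j$), $B_{i,j}(z)=[r_j]_zC_{j,i}(z)$ (that is $B(z)=(D(z)C(z))^{T}$ with $D(z)=\mathrm{diag}([r_i]_z)$,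 which is $D(z)C(z)$ when the latter is symmetric). Assume that $C(q^m)$ is invertible for all $m\ge 1$ and put $\tilde C(q^m)=C(q^m)^{-1}$, $\tilde B(q^m)=B(q^m)^{-1}$; note $C(z^{-1})=C(z)$. $\mathcal U_q(\hat{\mathfrak h})$ is the commutative $\mathbb C$-algebra with generators $k_\omega$ ($\omega\in\mathfrak h$), $h_{i,m}$ ($i\in I$, $m\in\mathbb Z\setminus\{0\}$) and relations $k_\omega k_{\omega'}=k_{\omega+\omega'}$, $k_0=1$, all generators commuting; $\phi^{\pm}_{i,\pm m}$ is defined by $\sum_{m\ge0}\phi^\pm_{i,\pm m}z^{\pm m}=k_{\pm r_i\alpha_i^\vee}\exp(\pm(q-q^{-1})\sum_{m\ge1}h_{i,\pm m}z^{\pm m})$. $\mathcal U_h(\hat{\mathfrak h})$ is the commutative $\mathbb C[[h]]$-algebra $h$-topologically generated (freely) by the vector space $\mathfrak h$ and the $h_{i,m}$, with $k_\omega=\exp(h\omega)$ in it, and $\hat\otimes$ is the $h$-completed tensor product. **The $q$-character.** Let $V$ be a finite-dimensional $\mathcal U_q(\hat{\mathfrak h})$-module that is $\mathcal U_q(\mathfrak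 h)$-diagonalizable, i.e. $V=\bigoplus_{\lambda\in\mathfrak h^*}V_\lambda$ with $V_\lambda=\{v: k_\omega v=q^{\lambda(\omega)}v\ \forall\omega\in\mathfrak h\}$. For an $l$-weight $(\lambda,\Psi)$ (where $\Psi=(\Psi^{\pm}_{i,\pm m})_{i\in I,m\ge0}$ are complex numbers with $\Psi^\pm_{i,0}=q_i^{\pm\lambda(\alpha_i^\vee)}$), let $V_{\lambda,\Psi}\subset V_\lambda$ be the simultaneous generalized eigenspace of the $\phi^\pm_{i,\pm m}$ with eigenvalues $\Psi^{\pm}_{i,\pm m}$. Assume that for every $(\lambda,\Psi)$ with $V_{\lambda,\Psi}\neq0$ there are polynomials $Q_i,R_i$ of constant term $1$ with $$\sum_{m\ge0}\Psi^\pm_{i,\pm m}z^{\pm m}=q_i^{\deg Q_i-\deg R_i}\frac{Q_i(zq_i^{-1})R_i(zq_i)}{Q_i(zq_i)R_i(zq_i^{-1})}$$ in $\mathbb C[[z]]$ (resp. $\mathbb C[[z^{-1}]]$). Writing $Q_i(u)=\prod_a(1-ua)^{\beta_{i,a}}$, $R_i(u)=\prod_a(1-ua)^{\gamma_{i,a}}$,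 put $Y_{\lambda,\Psi}=k_{\nu(\lambda)}\prod_{i,a}Y_{i,a}^{\beta_{i,a}-\gamma_{i,a}}$, an element of the group $\tilde A$ of formal monomials $k_\omega\prod_{i\in I,a\in\mathbb C^*}Y_{i,a}^{u_{i,a}}$ with $\omega\in\mathfrak h$, $u_{i,a}\in\mathbb Z$ almost all zero, and $\alpha_i(\omega)=r_i\sum_au_{i,a}$ for all $i$. Define $\chi_q(V)=\sum_{(\lambda,\Psi)}\dim(V_{\lambda,\Psi})\,Y_{\lambda,\Psi}\in\mathbb Z[\tilde A]$. Realize $\mathbb Z[\tilde A]$ in $\mathcal U_h(\hat{\mathfrak h})$ by the $\mathbb Z$-linear map $$k_\omega\prod_{i,a}Y_{i,a}^{u_{i,a}}\ \longmapsto\ \exp(-h\omega)\prod_{i,a}\exp\Big(-(q-q^{-1})\sum_{m\ge1}h^ma^m\tilde h_{i,-m}\Big)^{u_{i,a}},\qquad \tilde h_{i,m}=\sum_{j\in I}\tilde C_{j,i}(q^m)h_{j,m}.$$ **The element $\mathcal R^0T$.** Let $(\alpha_i)_{1\le i\le 2n-l}$ be a basis of $\mathfrak h^*$ extending the simple roots,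 with dual basis $(\Lambda_i^\vee)$ of $\mathfrak h$, and put, in $\mathcal U_h(\hat{\mathfrak h})\hat\otimes\,\mathcal U_h(\hat{\mathfrak h})$, $$\mathcal R^0=\exp\Big(-(q-q^{-1})\sum_{i,j\in I,\,m>0}\frac{m}{[m]_q}\tilde B_{i,j}(q^m)h^m\,h_{i,m}\otimes h_{j,-m}\Big),\qquad T=\exp\Big(-h\sum_{1\le i\le 2n-l}\Lambda_i^\vee\otimes\nu(\alpha_i)\Big).$$ Let $\pi_V(h):\mathcal U_h(\hat{\mathfrak h})\to\mathrm{End}(V)[[h]]$ be the $\mathbb C[[h]]$-algebra morphism for which $\omega\in\mathfrak h$ acts by $\lambda(\omega)$ on $V_\lambda$ and $h_{i,m}$ acts as in $V$. **Theorem.** For such a $V$, the element $\big((\mathrm{Tr}_V\circ\pi_V(h))\otimes\mathrm{Id}\big)(\mathcal R^0T)\in\mathcal U_h(\hat{\mathfrak h})$ is equal to (the realization in $\mathcal U_h(\hat{\mathfrak h})$ of) $\chi_q(V)$. -/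

import Mathlib

open scoped TensorProduct PowerSeries Polynomial

set_option linter.unusedSectionVars false

noncomputable section

namespace QAff

/-! ### Cartan matrices and realizations -/

/-- A symmetrizable generalized Cartan matrix `C`, with the symmetrizing integers `r i ≥ 1`
(so that `B = D C`, `D = diag (r i)`, is symmetric). -/
structure CartanDatum (I : Type*) where
  C : Matrix I I ℤ
  r : I → ℕ
  diag : ∀ i, C i i = 2
  offDiag : ∀ i j, i ≠ j → C i j ≤ 0
  zero_iff : ∀ i j, C i j = 0 ↔ C j i = 0
  r_pos : ∀ i, 0 < r i
  symm : ∀ i j, (r i : ℤ) * C i j = (r j : ℤ) * C j i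

/-- A realization `(𝔥, Π, Π^∨)` of the Cartan matrix over `ℚ` (with `dim 𝔥 = 2 n - rank C`),
together with a symmetric bilinear form on `𝔥^*` with `(α_i, μ) = μ (r_i α_i^∨)`. -/
structure Realization {I : Type*} [Fintype I] (A : CartanDatum I)
    (H : Type*) [AddCommGroup H] [Module ℚ H] where
  root : I → Module.Dual ℚ H
  coroot : I → H
  root_indep : LinearIndependent ℚ root
  coroot_indep : LinearIndependent ℚ coroot
  pairing : ∀ i j, root j (coroot i) = A.C i j
  dim_eq : Module.finrank ℚ H + (A.C.map (Int.cast : ℤ → ℚ)).rank = 2 * Fintype.card I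
  form : LinearMap.BilinForm ℚ (Module.Dual ℚ H)
  form_symm : ∀ x y, form x y = form y x
  form_root : ∀ i x, form (root i) x = x ((A.r i : ℚ) • coroot i)

/-- The map `ν : 𝔥^* → 𝔥` attached to the bilinear form: `μ (ν λ) = (λ, μ)`. -/
def Realization.nu {I : Type*} [Fintype I] {A : CartanDatum I}
    {H : Type*} [AddCommGroup H] [Module ℚ H] [Module.Finite ℚ H] (R : Realization A H) :
    Module.Dual ℚ H →ₗ[ℚ] H :=
  (Module.evalEquiv ℚ H).symm.toLinearMap ∘ₗ R.form

theorem Realization.apply_nu {I : Type*} [Fintype I] {A : CartanDatum I}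
    {H : Type*} [AddCommGroup H] [Module ℚ H] [Module.Finite ℚ H] (R : Realization A H)
    (lam mu : Module.Dual ℚ H) : mu (R.nu lam) = R.form lam mu := by
  simp [Realization.nu]

/-! ### `q`-numbers and quantized Cartan matrices -/

/-- `q ^ x` for rational `x`, where `q = exp τ`. -/
def qpow (τ : ℂ) (x : ℚ) : ℂ := Complex.exp (τ * (x : ℂ))

/-- The quantum integer `[l]_z = (z ^ l - z ^ (-l)) / (z - z⁻¹)`. -/
def qint (z : ℂ) (l : ℤ) : ℂ := (z ^ l - z ^ (-l)) / (z - z⁻¹)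

section Quantized

variable {I : Type*} [DecidableEq I]

/-- The value at `z` of the quantized Cartan matrix: `C_{ii}(z) = z_i + z_i⁻¹` with
`z_i = z ^ r_i`, and `C_{ij}(z) = [C_{ij}]_z` for `i ≠ j`. -/
def CartanDatum.Cz (A : CartanDatum I) (z : ℂ) : Matrix I I ℂ := fun i j =>
  if i = j then z ^ (A.r i) + (z ^ (A.r i))⁻¹ else qint z (A.C i j)

/-- The value at `z` of the diagonal matrix `D(z)`, `D_{ii}(z) = [r_i]_z`. -/
def CartanDatum.Dz (A : CartanDatum I) (z : ℂ) : Matrix I I ℂ :=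
  Matrix.diagonal fun i => qint z (A.r i)

variable [Fintype I]

/-- The value at `z` of `C̃(z) = C(z)⁻¹`. -/
def CartanDatum.Ctilde (A : CartanDatum I) (z : ℂ) : Matrix I I ℂ := (A.Cz z)⁻¹

/-- The value at `z` of the quantized symmetrized Cartan matrix,
`B_{ij}(z) = [r_j]_z C_{ji}(z)`, that is `B(z) = C(z)ᵀ D(z) = (D(z) C(z))ᵀ`.
It is `D(z) C(z)` whenever the latter is symmetric. -/
def CartanDatum.Bz (A : CartanDatum I) (z : ℂ) : Matrix I I ℂ := (A.Cz z).transpose * A.Dz z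

/-- The value at `z` of `B̃(z) = B(z)⁻¹`. -/
def CartanDatum.Btilde (A : CartanDatum I) (z : ℂ) : Matrix I I ℂ := (A.Bz z)⁻¹

end Quantized

/-! ### Formal exponentials -/

/-- The formal series `∑_{m ≥ 1} c m X ^ m`. -/
def posSeries {A : Type*} [Semiring A] (c : ℕ → A) : A⟦X⟧ :=
  PowerSeries.mk fun m => if m = 0 then 0 else c m

/-- `exp f = ∑_k f ^ k / k!` for a formal power series `f` without constant term
(then `f ^ k` does not contribute to the coefficient of `X ^ n` when `k > n`). -/
def pexp {A : Type*} [Ring A] [Algebra ℂ A] (f : A⟦X⟧) : A⟦X⟧ :=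
  PowerSeries.mk fun n =>
    ∑ k ∈ Finset.range (n + 1), ((k.factorial : ℂ)⁻¹) • PowerSeries.coeff n (f ^ k)

/-! ### The algebra `U_q(ĥ)` -/

/-- Generators `k_ω` (`ω ∈ 𝔥`) and `h_{i,m}` (`i ∈ I`, `m ∈ ℤ - {0}`). -/
inductive Gen (I : Type*) (H : Type*)
  | k (w : H) : Gen I H
  | h (i : I) (m : {m : ℤ // m ≠ 0}) : Gen I H

/-- The relations `k_a k_b = k_{a+b}`, `k_0 = 1`, `[k_a, h_{i,m}] = 0`, `[h_{i,m}, h_{j,l}] = 0`. -/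
inductive Rel (I : Type*) (H : Type*) [AddCommGroup H] :
    FreeAlgebra ℂ (Gen I H) → FreeAlgebra ℂ (Gen I H) → Prop
  | k_mul (a b : H) : Rel I H
      (FreeAlgebra.ι ℂ (Gen.k a) * FreeAlgebra.ι ℂ (Gen.k b)) (FreeAlgebra.ι ℂ (Gen.k (a + b)))
  | k_zero : Rel I H (FreeAlgebra.ι ℂ (Gen.k 0)) 1
  | k_h (a : H) (i : I) (m : {m : ℤ // m ≠ 0}) : Rel I H
      (FreeAlgebra.ι ℂ (Gen.k a) * FreeAlgebra.ι ℂ (Gen.h i m))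
      (FreeAlgebra.ι ℂ (Gen.h i m) * FreeAlgebra.ι ℂ (Gen.k a))
  | h_h (i j : I) (m l : {m : ℤ // m ≠ 0}) : Rel I H
      (FreeAlgebra.ι ℂ (Gen.h i m) * FreeAlgebra.ι ℂ (Gen.h j l))
      (FreeAlgebra.ι ℂ (Gen.h j l) * FreeAlgebra.ι ℂ (Gen.h i m))

/-- The algebra `U_q(ĥ)`. -/
abbrev Uq (I : Type*) (H : Type*) [AddCommGroup H] : Type _ := RingQuot (Rel I H)

section Uq

variable {I : Type*} {H : Type*} [AddCommGroup H]

variable (I) in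
/-- The element `k_ω` of `U_q(ĥ)`. -/
def Uq.k (w : H) : Uq I H := RingQuot.mkAlgHom ℂ (Rel I H) (FreeAlgebra.ι ℂ (Gen.k w))

variable (H) in
/-- The element `h_{i,m}` of `U_q(ĥ)` (`0` by convention for `m = 0`, which is never used). -/
def Uq.h (i : I) (m : ℤ) : Uq I H :=
  if hm : m ≠ 0 then RingQuot.mkAlgHom ℂ (Rel I H) (FreeAlgebra.ι ℂ (Gen.h i ⟨m, hm⟩)) else 0

theorem Uq.k_mul_h (w : H) (i : I) (m : ℤ) :
    Uq.k I w * Uq.h H i m = Uq.h H i m * Uq.k I w := by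
  unfold Uq.k Uq.h
  split_ifs with hm
  · rw [← map_mul, ← map_mul]
    exact RingQuot.mkAlgHom_rel ℂ (Rel.k_h w i ⟨m, hm⟩)
  · simp

theorem Uq.h_mul_h (i j : I) (m l : ℤ) :
    Uq.h H i m * Uq.h H j l = Uq.h H j l * Uq.h H i m := by
  unfold Uq.h
  split_ifs with hm hl
  · rw [← map_mul, ← map_mul]
    exact RingQuot.mkAlgHom_rel ℂ (Rel.h_h i j ⟨m, hm⟩ ⟨l, hl⟩)
  all_goals simp

end Uq

section Main

variable {I : Type*} [Fintype I] {A : CartanDatum I}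
  {H : Type*} [AddCommGroup H] [Module ℚ H]

/-- For a sign `s`, the series `∑_{m ≥ 0} φ^s_{i,sm} X ^ m` (where `X` stands for `z ^ s`), i.e.
`k_{s r_i α_i^∨} exp (s (q - q⁻¹) ∑_{m ≥ 1} h_{i,sm} X ^ m)`. -/
def phi (R : Realization A H) (τ : ℂ) (s : ℤˣ) (i : I) : (Uq I H)⟦X⟧ :=
  PowerSeries.C (Uq.k I (((s : ℤ) * (A.r i : ℚ)) • R.coroot i)) *
    pexp (posSeries fun m =>
      (((s : ℤ) : ℂ) * (qpow τ 1 - qpow τ (-1))) • Uq.h H i ((s : ℤ) * (m : ℤ)))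

/-! ### Weights and `l`-weights -/

/-- An `l`-weight `(λ, Ψ)`: `Ψ s i m` is `Ψ^s_{i,sm}`, and `Ψ^±_{i,0} = q_i ^ (± λ(α_i^∨))`,
`q_i = q ^ r_i`. -/
@[ext] structure LWeight (R : Realization A H) (τ : ℂ) where
  wt : Module.Dual ℚ H
  Psi : ℤˣ → I → ℕ → ℂ
  compat : ∀ (s : ℤˣ) (i : I), Psi s i 0 = qpow τ ((s : ℤ) * ((A.r i : ℚ) * wt (R.coroot i)))

/-- `(Q, P)` are polynomials of constant term `1` with
`∑_{m ≥ 0} Ψ^±_{i,±m} z^{±m}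
  = q_i^{deg Q_i - deg P_i} Q_i(z q_i⁻¹) P_i(z q_i) / (Q_i(z q_i) P_i(z q_i⁻¹))`
in `ℂ[[z]]` (resp. in `ℂ[[z⁻¹]]`). The numerator and the denominator have the same degree
`d = deg Q_i + deg P_i`; the identity in `ℂ[[z⁻¹]]` is written after multiplying both of them by
`z ^ (-d)`, which turns them into their reversed polynomials in the variable `z⁻¹`. -/
def LWeight.IsPair {R : Realization A H} {τ : ℂ} (Γ : LWeight R τ) (Q P : I → ℂ[X]) : Prop :=
  ∀ i, (Q i).coeff 0 = 1 ∧ (P i).coeff 0 = 1 ∧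
    let qi : ℂ := qpow τ (A.r i)
    let c : ℂ := qi ^ (((Q i).natDegree : ℤ) - ((P i).natDegree : ℤ))
    let num : ℂ[X] := (Q i).comp (Polynomial.C qi⁻¹ * Polynomial.X) *
      (P i).comp (Polynomial.C qi * Polynomial.X)
    let den : ℂ[X] := (Q i).comp (Polynomial.C qi * Polynomial.X) *
      (P i).comp (Polynomial.C qi⁻¹ * Polynomial.X)
    PowerSeries.mk (Γ.Psi 1 i) * (den : ℂ⟦X⟧) = PowerSeries.C c * (num : ℂ⟦X⟧) ∧
    PowerSeries.mk (Γ.Psi (-1) i) * (den.reverse : ℂ⟦X⟧) =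
      PowerSeries.C c * (num.reverse : ℂ⟦X⟧)

/-- The `l`-weights to which a monomial `Y_{μ,Γ}` is attached. -/
def LWeight.IsRational {R : Realization A H} {τ : ℂ} (Γ : LWeight R τ) : Prop :=
  ∃ Q P : I → ℂ[X], Γ.IsPair Q P

section Module

variable (V : Type*) [AddCommGroup V] [Module ℂ V] [Module (Uq I H) V] [IsScalarTower ℂ (Uq I H) V]

/-- The operator on `V` given by an element of `U_q(ĥ)`. -/
abbrev act : Uq I H →ₐ[ℂ] Module.End ℂ V := Algebra.lsmul ℂ ℂ V

variable (I) in
/-- The weight space `V_λ = {v | ∀ ω ∈ 𝔥, k_ω v = q ^ λ(ω) v}`. -/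
def weightSpace (τ : ℂ) (lam : Module.Dual ℚ H) : Submodule ℂ V where
  carrier := {v | ∀ w : H, Uq.k I w • v = qpow τ (lam w) • v}
  add_mem' := by
    intro a b ha hb w
    rw [smul_add, smul_add, ha w, hb w]
  zero_mem' := by intro w; simp
  smul_mem' := by
    intro c v hv w
    rw [smul_comm, hv w, smul_comm]

open Classical in
variable (I H) in
/-- `V` is `U_q(𝔥)`-diagonalizable: `V` is the direct sum of its weight spaces. -/
def IsDiagonalizable (τ : ℂ) : Prop :=
  DirectSum.IsInternal fun lam : Module.Dual ℚ H => weightSpace I V τ lam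

/-- The space `V_{λ,Ψ}`: simultaneous generalized eigenspace in `V_λ`. -/
def lWeightSpace {R : Realization A H} {τ : ℂ} (Γ : LWeight R τ) : Submodule ℂ V where
  carrier := {v | v ∈ weightSpace I V τ Γ.wt ∧ ∃ p : ℕ, ∀ (s : ℤˣ) (i : I) (m : ℕ),
    ((act V (PowerSeries.coeff m (phi R τ s i)) -
      algebraMap ℂ (Module.End ℂ V) (Γ.Psi s i m)) ^ p) v = 0}
  add_mem' := by
    rintro a b ⟨ha, p, hp⟩ ⟨hb, p', hp'⟩
    refine ⟨add_mem ha hb, max p p', fun s i m => ?_⟩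
    rw [map_add, Module.End.pow_map_zero_of_le (le_max_left _ _) (hp s i m),
      Module.End.pow_map_zero_of_le (le_max_right _ _) (hp' s i m), add_zero]
  zero_mem' := ⟨zero_mem _, 0, by intros; simp⟩
  smul_mem' := by
    rintro c v ⟨hv, p, hp⟩
    exact ⟨Submodule.smul_mem _ c hv, p, fun s i m => by rw [map_smul, hp, smul_zero]⟩

end Module

/-! ### Monomials -/

/-- The sum of the exponents `u_i = ∑_a u_{i,a}`. -/
def expSum (u : ℂˣ →₀ ℤ) : ℤ := u.sum fun _ n => n

theorem expSum_add (u v : ℂˣ →₀ ℤ) : expSum (u + v) = expSum u + expSum v :=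
  Finsupp.sum_add_index' (fun _ => rfl) (fun _ _ _ => rfl)

/-- The commutative group `Ã` (written additively) of the monomials
`∏_{i,a} Y_{i,a}^{u_{i,a}} k_ω`, encoded as pairs `(ω, u)`, with `α_i(ω) = r_i ∑_a u_{i,a}`. -/
def Atilde (R : Realization A H) : AddSubgroup (H × (I → ℂˣ →₀ ℤ)) where
  carrier := {m | ∀ i, R.root i m.1 = (A.r i : ℚ) * (expSum (m.2 i) : ℤ)}
  add_mem' := by
    intro a b ha hb i
    simp only [Prod.fst_add, Prod.snd_add, Pi.add_apply, map_add, expSum_add, ha i, hb i]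
    push_cast
    ring
  zero_mem' := by intro i; simp [expSum]
  neg_mem' := by
    intro a ha i
    have h1 : expSum (-(a.2 i)) = - expSum (a.2 i) := by
      have h2 := expSum_add (a.2 i) (-(a.2 i))
      rw [add_neg_cancel] at h2
      have h3 : expSum 0 = 0 := Finsupp.sum_zero_index
      lia
    simp only [Prod.fst_neg, Prod.snd_neg, Pi.neg_apply, map_neg, h1, ha i]
    push_cast
    ring

/-- The exponents `β_a` in `Q(u) = ∏_a (1 - u a) ^ β_a` (for `Q` of constant term `1`). -/
def factorExp (Q : ℂ[X]) : ℂˣ →₀ ℤ :=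
  Finsupp.ofSupportFinite (fun a : ℂˣ => (Q.rootMultiplicity ((a⁻¹ : ℂˣ) : ℂ) : ℤ)) (by
    have hinj : Function.Injective fun a : ℂˣ => ((a⁻¹ : ℂˣ) : ℂ) :=
      Units.val_injective.comp inv_injective
    refine Set.Finite.subset (Set.Finite.preimage hinj.injOn Q.roots.toFinset.finite_toSet) ?_
    intro a ha
    have h1 : Q.roots.count ((a⁻¹ : ℂˣ) : ℂ) ≠ 0 := by
      rw [Polynomial.count_roots]
      exact_mod_cast (Function.mem_support.1 ha)
    simpa using (Multiset.count_ne_zero.1 h1))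

theorem expSum_factorExp (Q : ℂ[X]) (h0 : Q.coeff 0 = 1) :
    expSum (factorExp Q) = Q.natDegree := by
  classical
  have hQ : Q ≠ 0 := by
    rintro rfl
    simp at h0
  have hroot : ∀ x ∈ Q.roots, x ≠ 0 := by
    rintro x hx rfl
    have h1 := Polynomial.isRoot_of_mem_roots hx
    rw [Polynomial.IsRoot, ← Polynomial.coeff_zero_eq_eval_zero, h0] at h1
    exact one_ne_zero h1
  rw [(IsAlgClosed.splits Q).natDegree_eq_card_roots, ← Multiset.toFinset_sum_count_eq]
  unfold expSum Finsupp.sum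
  push_cast
  refine Finset.sum_bij (fun a _ => ((a⁻¹ : ℂˣ) : ℂ)) ?_ ?_ ?_ ?_
  · intro a ha
    have h1 : Q.roots.count ((a⁻¹ : ℂˣ) : ℂ) ≠ 0 := by
      have h2 : ((Q.rootMultiplicity ((a⁻¹ : ℂˣ) : ℂ) : ℕ) : ℤ) ≠ 0 :=
        Finsupp.mem_support_iff.1 ha
      rw [Polynomial.count_roots]
      exact_mod_cast h2
    simpa using (Multiset.count_ne_zero.1 h1)
  · intro a _ b _ hab
    exact inv_injective (Units.val_injective hab)
  · intro x hx
    have hx' : x ∈ Q.roots := by simpa using hx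
    refine ⟨(Units.mk0 x (hroot x hx'))⁻¹, ?_, by simp⟩
    rw [Finsupp.mem_support_iff]
    change ((Q.rootMultiplicity _ : ℕ) : ℤ) ≠ 0
    rw [inv_inv, Units.val_mk0, ← Polynomial.count_roots]
    exact_mod_cast Multiset.count_ne_zero.2 hx'
  · intro a _
    change ((Q.rootMultiplicity _ : ℕ) : ℤ) = _
    rw [Polynomial.count_roots]

/-- `q = exp τ` is not a root of unity. -/
def NotRootOfUnity (τ : ℂ) : Prop := ∀ n : ℕ, n ≠ 0 → Complex.exp τ ^ n ≠ 1

theorem qpow_injective {τ : ℂ} (hq : NotRootOfUnity τ) : Function.Injective (qpow τ) := by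
  have key : ∀ x : ℚ, qpow τ x = 1 → x = 0 := by
    intro x hx
    by_contra hne
    have hd : (x.den : ℂ) ≠ 0 := by exact_mod_cast x.den_nz
    have h1 : Complex.exp (τ * (x.num : ℂ)) = 1 := by
      have h2 : τ * (x.num : ℂ) = (x.den : ℂ) * (τ * (x : ℂ)) := by
        have h3 : (x : ℂ) = (x.num : ℂ) / (x.den : ℂ) := Rat.cast_def x
        rw [h3]
        field_simp
      unfold qpow at hx
      rw [h2, Complex.exp_nat_mul, hx, one_pow]
    have hn : x.num.natAbs ≠ 0 := by simpa using hne
    apply hq _ hn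
    rw [mul_comm, Complex.exp_int_mul] at h1
    rcases Int.natAbs_eq x.num with h | h
    · rw [h, zpow_natCast] at h1
      exact h1
    · rw [h, zpow_neg, zpow_natCast, inv_eq_one] at h1
      exact h1
  intro x y hxy
  have h : qpow τ (x - y) = 1 := by
    unfold qpow at *
    push_cast
    rw [mul_sub, Complex.exp_sub, hxy, div_self (Complex.exp_ne_zero _)]
  linarith [key _ h]

theorem LWeight.IsPair.wt_coroot {R : Realization A H} {τ : ℂ} (hq : NotRootOfUnity τ)
    {Γ : LWeight R τ} {Q P : I → ℂ[X]} (h : Γ.IsPair Q P) (i : I) :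
    Γ.wt (R.coroot i) = ((Q i).natDegree : ℚ) - ((P i).natDegree : ℚ) := by
  obtain ⟨hQ, hP, h1, -⟩ := h i
  have h2 := congrArg PowerSeries.constantCoeff h1
  rw [Polynomial.coeff_zero_eq_eval_zero] at hQ hP
  simp only [map_mul, ← PowerSeries.coeff_zero_eq_constantCoeff_apply,
    Polynomial.coeff_coe, PowerSeries.coeff_mk, Polynomial.coeff_zero_eq_eval_zero,
    Polynomial.eval_mul, Polynomial.eval_comp, Polynomial.eval_C, Polynomial.eval_X, mul_zero,
    hQ, hP, mul_one, PowerSeries.coeff_zero_C] at h2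
  rw [Γ.compat] at h2
  have h3 : qpow τ (A.r i) ^ (((Q i).natDegree : ℤ) - ((P i).natDegree : ℤ)) =
      qpow τ ((A.r i : ℚ) * (((Q i).natDegree : ℚ) - ((P i).natDegree : ℚ))) := by
    unfold qpow
    rw [← Complex.exp_int_mul]
    push_cast
    ring_nf
  rw [h3] at h2
  have h4 := qpow_injective hq h2
  have h5 : (A.r i : ℚ) ≠ 0 := by exact_mod_cast (A.r_pos i).ne'
  simpa [h5] using h4

section QChar

variable [Module.Finite ℚ H]

/-- The monomial `Y_{μ,Γ} = k_{ν(μ)} ∏_{i,a} Y_{i,a}^{β_{i,a} - γ_{i,a}}`, where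
`Q_i(u) = ∏_a (1 - u a) ^ β_{i,a}` and `P_i(u) = ∏_a (1 - u a) ^ γ_{i,a}`
(it does not depend on the choice of the polynomials). -/
def monomial {R : Realization A H} {τ : ℂ} (hq : NotRootOfUnity τ)
    (Γ : {Γ : LWeight R τ // Γ.IsRational}) : Atilde R :=
  ⟨(R.nu Γ.1.wt,
    fun i => factorExp (Γ.2.choose i) - factorExp (Γ.2.choose_spec.choose i)), by
    intro i
    have hp := Γ.2.choose_spec.choose_spec
    have h1 : expSum (factorExp (Γ.2.choose i) - factorExp (Γ.2.choose_spec.choose i)) =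
        ((Γ.2.choose i).natDegree : ℤ) - ((Γ.2.choose_spec.choose i).natDegree : ℤ) := by
      have h2 := expSum_add (factorExp (Γ.2.choose i) - factorExp (Γ.2.choose_spec.choose i))
        (factorExp (Γ.2.choose_spec.choose i))
      rw [sub_add_cancel, expSum_factorExp _ (hp i).1, expSum_factorExp _ (hp i).2.1] at h2
      lia
    rw [R.apply_nu, R.form_symm, R.form_root, map_smul, hp.wt_coroot hq i]
    simp only [h1, smul_eq_mul]
    push_cast
    ring⟩

/-- The `q`-character `χ_q(V) = ∑_{(μ,Γ)} dim (V_{μ,Γ}) Y_{μ,Γ} ∈ ℤ[Ã]` of a finite-dimensional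
module; only finitely many `l`-weights `(μ,Γ)` have `V_{μ,Γ} ≠ 0`. -/
def qChar (R : Realization A H) {τ : ℂ} (hq : NotRootOfUnity τ)
    (V : Type*) [AddCommGroup V] [Module ℂ V] [Module (Uq I H) V] [IsScalarTower ℂ (Uq I H) V] :
    AddMonoidAlgebra ℤ (Atilde R) :=
  ∑ᶠ Γ : {Γ : LWeight R τ // Γ.IsRational},
    AddMonoidAlgebra.single (monomial hq Γ) (Module.finrank ℂ (lWeightSpace V Γ.1) : ℤ)

end QChar

/-! ### The `h`-adic algebras -/

/-- The symmetric algebra on `(𝔥 ⊗ ℂ) ⊕ ⨁_{i, m ≠ 0} ℂ h_{i,m}`. -/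
abbrev SymH (I : Type*) (H : Type*) [AddCommGroup H] [Module ℚ H] : Type _ :=
  SymmetricAlgebra ℂ ((ℂ ⊗[ℚ] H) × ((I × {m : ℤ // m ≠ 0}) →₀ ℂ))

/-- `U_h(ĥ)`: the commutative `ℂ[[h]]`-algebra topologically generated by `𝔥` and the `h_{i,m}`,
i.e. the algebra of formal power series in `h` over the symmetric algebra. -/
abbrev Uh (I : Type*) (H : Type*) [AddCommGroup H] [Module ℚ H] : Type _ := (SymH I H)⟦X⟧

/-- The `h`-adically completed tensor product `U_h(ĥ) ⊗̂ U_h(ĥ)`. -/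
abbrev Uh2 (I : Type*) (H : Type*) [AddCommGroup H] [Module ℚ H] : Type _ :=
  (SymH I H ⊗[ℂ] SymH I H)⟦X⟧

variable (I) in
/-- The element `ω ∈ 𝔥` of `U_h(ĥ)`. -/
def el (w : H) : SymH I H := SymmetricAlgebra.ι ℂ _ ((1 : ℂ) ⊗ₜ[ℚ] w, 0)

variable (H) in
/-- The element `h_{i,m}` of `U_h(ĥ)` (`0` by convention for `m = 0`, which is never used). -/
def hel (i : I) (m : ℤ) : SymH I H :=
  if hm : m ≠ 0 then SymmetricAlgebra.ι ℂ _ (0, Finsupp.single (i, ⟨m, hm⟩) 1) else 0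

variable (I) in
/-- `k_ω = exp (h ω)` in `U_h(ĥ)`. -/
def kh (w : H) : Uh I H := pexp (PowerSeries.C (el I w) * PowerSeries.X)

section Quantized

variable [DecidableEq I]

variable (A H) in
/-- `h̃_{i,m} = ∑_j C̃_{ji}(q^m) h_{j,m}`. -/
def htilde (τ : ℂ) (i : I) (m : ℤ) : SymH I H :=
  ∑ j, A.Ctilde (qpow τ m) j i • hel H j m

variable (A H) in
/-- `exp (-(q - q⁻¹) ∑_{m ≥ 1} h^m a^m h̃_{i,-m})`. -/
def Yexp (τ : ℂ) (i : I) (a : ℂˣ) : Uh I H :=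
  pexp (posSeries fun m =>
    (-(qpow τ 1 - qpow τ (-1)) * (a : ℂ) ^ m) • htilde A H τ i (-(m : ℤ)))

theorem isUnit_Yexp (τ : ℂ) (i : I) (a : ℂˣ) : IsUnit (Yexp A H τ i a) := by
  rw [PowerSeries.isUnit_iff_constantCoeff, ← PowerSeries.coeff_zero_eq_constantCoeff_apply]
  simp [Yexp, pexp]

/-- The realization of a monomial of `Ã` in `U_h(ĥ)`:
`k_ω ∏_{i,a} Y_{i,a}^{u_{i,a}}` is the element
`exp (- h ω) ∏_{i,a} exp (-(q - q⁻¹) ∑_{m ≥ 1} h^m a^m h̃_{i,-m}) ^ u_{i,a}`.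
In particular, `k_{ν(Λ_i)} Y_{i,a}` is
`k_{-ν(Λ_i)} exp (-(q - q⁻¹) ∑_{m ≥ 1} h^m a^m h̃_{i,-m})`. -/
def realizeMonomial (R : Realization A H) (τ : ℂ) (m : Atilde R) : Uh I H :=
  kh I (-m.1.1) * ∏ i : I, (m.1.2 i).prod fun a n =>
    (((isUnit_Yexp (A := A) (H := H) τ i a).unit ^ n : (Uh I H)ˣ) : Uh I H)

/-- The `ℤ`-linear extension `ℤ[Ã] → U_h(ĥ)`. -/
def realize (R : Realization A H) (τ : ℂ) (x : AddMonoidAlgebra ℤ (Atilde R)) : Uh I H :=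
  x.coeff.sum fun m n => n • realizeMonomial R τ m

variable (A H) in
/-- `R⁰ = exp (-(q - q⁻¹) ∑_{i,j, m > 0} (m / [m]_q) B̃_{ij}(q^m) h^m h_{i,m} ⊗ h_{j,-m})`. -/
def R0 (τ : ℂ) : Uh2 I H :=
  pexp (posSeries fun m => (-(qpow τ 1 - qpow τ (-1))) • ∑ i : I, ∑ j : I,
    ((m : ℂ) / qint (qpow τ 1) m * A.Btilde (qpow τ m) i j) •
      (hel H i m ⊗ₜ[ℂ] hel H j (-(m : ℤ))))

end Quantized

/-- `T = exp (- h ∑_x Λ_x^∨ ⊗ ν(α_x))`, for a basis `(Λ_x^∨)` of `𝔥` and its dual basis `(α_x)`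
of `𝔥^*`. -/
def T [Module.Finite ℚ H] (R : Realization A H) {X : Type*} [Fintype X]
    (Lam : Module.Basis X ℚ H) : Uh2 I H :=
  pexp (-(PowerSeries.C (∑ x, el I (Lam x) ⊗ₜ[ℂ] el I (R.nu (Lam.coord x))) * PowerSeries.X))

/-! ### The morphism `π_V(h)` and the partial trace -/

section Trace

variable (V : Type*) [AddCommGroup V] [Module ℂ V] [Module (Uq I H) V] [IsScalarTower ℂ (Uq I H) V]

/-- The `ℂ`-linear extension `𝔥 ⊗ ℂ → ℂ` of `λ ∈ 𝔥^*`. -/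
def extWeight (lam : Module.Dual ℚ H) : ℂ ⊗[ℚ] H →ₗ[ℂ] ℂ :=
  LinearMap.liftBaseChange ℂ ((Algebra.linearMap ℚ ℂ) ∘ₗ lam)

variable {V} {τ : ℂ}

open Classical in
/-- The identification of a diagonalizable module with the direct sum of its weight spaces. -/
def decomp (hV : IsDiagonalizable I H V τ) :
    (DirectSum (Module.Dual ℚ H) fun lam => weightSpace I V τ lam) ≃ₗ[ℂ] V :=
  LinearEquiv.ofBijective
    (DirectSum.coeLinearMap fun lam : Module.Dual ℚ H => weightSpace I V τ lam) hV

open Classical in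
/-- The operator `v ↦ λ(ω) v` (for `v ∈ V_λ`) on a diagonalizable module. -/
def cartanOp (hV : IsDiagonalizable I H V τ) (w : ℂ ⊗[ℚ] H) : Module.End ℂ V :=
  (DirectSum.toModule ℂ (Module.Dual ℚ H) V fun lam =>
    extWeight lam w • (weightSpace I V τ lam).subtype) ∘ₗ (decomp hV).symm.toLinearMap

theorem cartanOp_apply (hV : IsDiagonalizable I H V τ) (w : ℂ ⊗[ℚ] H) {lam : Module.Dual ℚ H}
    {v : V} (hv : v ∈ weightSpace I V τ lam) : cartanOp hV w v = extWeight lam w • v := by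
  classical
  have h1 : (decomp hV).symm v =
      DirectSum.lof ℂ _ (fun lam : Module.Dual ℚ H => weightSpace I V τ lam) lam ⟨v, hv⟩ := by
    rw [LinearEquiv.symm_apply_eq]
    exact (DirectSum.coeLinearMap_lof _ lam ⟨v, hv⟩).symm
  unfold cartanOp
  rw [LinearMap.comp_apply, LinearEquiv.coe_coe, h1]
  convert DirectSum.toModule_lof ℂ lam _ using 1
  rfl

theorem end_ext (hV : IsDiagonalizable I H V τ) {f g : Module.End ℂ V}
    (h : ∀ lam, ∀ v ∈ weightSpace I (H := H) V τ lam, f v = g v) : f = g := by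
  classical
  have h1 := DirectSum.IsInternal.submodule_iSup_eq_top hV
  ext v
  have hv : v ∈ ⨆ lam : Module.Dual ℚ H, weightSpace I V τ lam := h1 ▸ Submodule.mem_top
  induction hv using Submodule.iSup_induction' with
  | mem lam v hv => exact h lam v hv
  | zero => simp
  | add x y _ _ hx hy => simp [hx, hy]

/-- The linear map defining `π_V`: `ω ∈ 𝔥` acts by `λ(ω)` on `V_λ`, and `h_{i,m}` acts as it does
in the `U_q(ĥ)`-module `V`. -/
def genOp (hV : IsDiagonalizable I H V τ) :
    ((ℂ ⊗[ℚ] H) × ((I × {m : ℤ // m ≠ 0}) →₀ ℂ)) →ₗ[ℂ] Module.End ℂ V :=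
  LinearMap.coprod
    { toFun := cartanOp hV
      map_add' := fun x y => end_ext hV fun lam v hv => by
        simp [cartanOp_apply hV _ hv, add_smul]
      map_smul' := fun c x => end_ext hV fun lam v hv => by
        simp [cartanOp_apply hV _ hv, mul_smul] }
    (Finsupp.linearCombination ℂ fun p : I × {m : ℤ // m ≠ 0} => act V (Uq.h H p.1 p.2))

theorem genOp_comm (hV : IsDiagonalizable I H V τ)
    (x y : (ℂ ⊗[ℚ] H) × ((I × {m : ℤ // m ≠ 0}) →₀ ℂ)) :
    Commute (genOp hV x) (genOp hV y) := by
  have hst : ∀ (i : I) (m : ℤ) (lam : Module.Dual ℚ H) (v : V), v ∈ weightSpace I V τ lam →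
      Uq.h H i m • v ∈ weightSpace I V τ lam := by
    intro i m lam v hv w
    rw [← mul_smul, Uq.k_mul_h, mul_smul, hv w, smul_comm]
  have hcc : ∀ a b, Commute (cartanOp hV a) (cartanOp hV b) := fun a b =>
    end_ext hV fun lam v hv => by
      rw [Module.End.mul_apply, Module.End.mul_apply, cartanOp_apply hV b hv,
        cartanOp_apply hV a hv, map_smul, map_smul, cartanOp_apply hV b hv,
        cartanOp_apply hV a hv, smul_comm]
  have hch : ∀ (a : ℂ ⊗[ℚ] H) (i : I) (m : ℤ),
      Commute (cartanOp hV a) (act V (Uq.h H i m)) := fun a i m =>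
    end_ext hV fun lam v hv => by
      rw [Module.End.mul_apply, Module.End.mul_apply, cartanOp_apply hV a hv, map_smul]
      exact cartanOp_apply hV a (hst i m lam v hv)
  have hhh : ∀ (i : I) (m : ℤ) (j : I) (l : ℤ),
      Commute (act V (Uq.h H i m)) (act V (Uq.h H j l)) := fun i m j l => by
    rw [commute_iff_eq, ← map_mul, ← map_mul, Uq.h_mul_h]
  have hcs : ∀ a f, Commute (cartanOp hV a)
      (Finsupp.linearCombination ℂ
        (fun p : I × {m : ℤ // m ≠ 0} => act V (Uq.h H p.1 p.2)) f) := fun a f => by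
    rw [Finsupp.linearCombination_apply]
    exact Commute.sum_right _ _ _ fun p _ => (hch a p.1 p.2).smul_right _
  have hss : ∀ f g, Commute
      (Finsupp.linearCombination ℂ
        (fun p : I × {m : ℤ // m ≠ 0} => act V (Uq.h H p.1 p.2)) f)
      (Finsupp.linearCombination ℂ
        (fun p : I × {m : ℤ // m ≠ 0} => act V (Uq.h H p.1 p.2)) g) := fun f g => by
    rw [Finsupp.linearCombination_apply, Finsupp.linearCombination_apply]
    exact Commute.sum_right _ _ _ fun p _ => Commute.smul_right
      (Commute.sum_left _ _ _ fun p' _ => (hhh _ _ _ _).smul_left _) _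
  change Commute (cartanOp hV x.1 + Finsupp.linearCombination ℂ _ x.2)
    (cartanOp hV y.1 + Finsupp.linearCombination ℂ _ y.2)
  exact ((hcc _ _).add_right (hcs _ _)).add_left ((hcs _ _).symm.add_right (hss _ _))

/-- The algebra morphism `Sym → End(V)` determined by `genOp`. -/
def piV (hV : IsDiagonalizable I H V τ) : SymH I H →ₐ[ℂ] Module.End ℂ V :=
  RingCon.liftₐ (TensorAlgebra.symRingCon ℂ _) (TensorAlgebra.lift ℂ (genOp hV)) (by
    refine RingCon.ringConGen_le.2 (fun x y h' => ?_)
    induction h' with | mul_comm x y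
    rw [RingCon.ker_apply, map_mul, map_mul]
    simpa using (genOp_comm hV x y).eq)

theorem piV_ι (hV : IsDiagonalizable I H V τ)
    (x : (ℂ ⊗[ℚ] H) × ((I × {m : ℤ // m ≠ 0}) →₀ ℂ)) :
    piV hV (SymmetricAlgebra.ι ℂ _ x) = genOp hV x := by
  change TensorAlgebra.lift ℂ (genOp hV) (TensorAlgebra.ι ℂ x) = _
  simp

/-- `(Tr_V ∘ π_V(h)) ⊗ Id : U_h(ĥ) ⊗̂ U_h(ĥ) → U_h(ĥ)`, the `h`-adically continuous
`ℂ[[h]]`-linear map with `x ⊗ y ↦ Tr_V(π_V(x)) y`. -/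
def traceId (hV : IsDiagonalizable I H V τ) (F : Uh2 I H) : Uh I H :=
  PowerSeries.mk fun n =>
    TensorProduct.lid ℂ (SymH I H)
      (TensorProduct.map (LinearMap.trace ℂ V ∘ₗ (piV hV).toLinearMap) LinearMap.id
        (PowerSeries.coeff n F))

end Trace

end Main

end QAff

end

/-! The algebra $\mathcal U_q(\hat{\mathfrak h})$ is commutative and $V$ is finite-dimensional over
$\mathbb C$, so $V$ is the direct sum of the joint generalized eigenspaces `charSpace V χ` of the
whole algebra, for finitely many characters `χ` (`isInternal_charSpace`). Diagonalizability gives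
each `χ` a weight $\lambda$ (`exists_weight`). Since $q$ is not a root of unity, `χ` is determined
by its $l$-weight, and the nonzero $l$-weight spaces are exactly the character spaces
(`charLWeight_injective`, `lWeightSpace_charLWeight`, `lWeightSpace_eq_bot`). Hence $\chi_q(V)$ is a
sum over the `χ`.

On `charSpace V χ` each $\pi_V(x)$ has a single generalized eigenvalue $\theta(x)$, where $\theta$ =
`symChar` is itself a character. The trace is therefore $\sum_\chi\dim\cdot\,\theta$, and the
partial trace is a sum of algebra morphisms $\theta\otimes\mathrm{id}$ (`traceId_eq_sum`). These
pass through exponentials, so they can be evaluated on $\mathcal R^0$ and $T$ separately.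

Expanding $\lambda$ in the basis dual to $(\Lambda^\vee_x)$ sends $T$ to $\exp(-h\nu(\lambda))$. For
$\mathcal R^0$, let $p_{i,m}=\sum_a(\beta_{i,a}-\gamma_{i,a})a^m$. The logarithm of the rational
function attached to $\Psi$ gives $(q-q^{-1})\chi(h_{i,m})=(q_i^m-q_i^{-m})\,p_{i,m}/m$ (`char_h`).
Thus $\frac m{[m]_q}\chi(h_{i,m})=[r_i]_{q^m}p_{i,m}$, and $[r_i]_{q^m}\tilde B_{i,j}(q^m)=\tilde
C_{j,i}(q^m)$ turns the sum over $j$ into $p_{i,m}\tilde h_{i,-m}$ (`charId_htilde_term`). The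
product of the $Y_{i,a}$ has this same exponent (`prod_Yexp_eq`). -/

noncomputable section

namespace QAff

/-! ### Properties of formal exponentials -/

section Pexp

variable {A : Type*} [CommRing A] [Algebra ℂ A]

theorem coeff_pow_eq_zero_of_lt {A : Type*} [Semiring A] {f : A⟦X⟧}
    (hf : PowerSeries.constantCoeff f = 0) {n k : ℕ} (h : n < k) :
    PowerSeries.coeff n (f ^ k) = 0 := by
  apply PowerSeries.coeff_of_lt_order
  refine lt_of_lt_of_le ?_ (PowerSeries.le_order_pow_of_constantCoeff_eq_zero k hf)
  exact_mod_cast h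

theorem constantCoeff_posSeries {A : Type*} [Semiring A] (c : ℕ → A) :
    PowerSeries.constantCoeff (posSeries c) = 0 := by
  rw [← PowerSeries.coeff_zero_eq_constantCoeff_apply]
  simp [posSeries]

theorem coeff_posSeries {A : Type*} [Semiring A] (c : ℕ → A) {m : ℕ} (hm : m ≠ 0) :
    PowerSeries.coeff m (posSeries c) = c m := by
  simp [posSeries, hm]

theorem posSeries_congr {A : Type*} [Semiring A] {c d : ℕ → A} (h : ∀ m, m ≠ 0 → c m = d m) :
    posSeries c = posSeries d := by
  ext m
  by_cases hm : m = 0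
  · simp [posSeries, hm]
  · rw [coeff_posSeries _ hm, coeff_posSeries _ hm, h m hm]

theorem map_posSeries {A B : Type*} [Semiring A] [Semiring B] (φ : A →+* B) (c : ℕ → A) :
    PowerSeries.map φ (posSeries c) = posSeries fun m => φ (c m) := by
  ext m
  rw [PowerSeries.coeff_map]
  simp only [posSeries, PowerSeries.coeff_mk]
  split_ifs <;> simp

/-- The truncation may be lengthened at will, so one range can serve all the coefficients that enter
a product. -/
theorem coeff_pexp {A : Type*} [Ring A] [Algebra ℂ A] {f : A⟦X⟧}
    (hf : PowerSeries.constantCoeff f = 0) {n N : ℕ} (h : n < N) :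
    PowerSeries.coeff n (pexp f) =
      ∑ k ∈ Finset.range N, ((k.factorial : ℂ)⁻¹) • PowerSeries.coeff n (f ^ k) := by
  simp only [pexp, PowerSeries.coeff_mk]
  refine Finset.sum_subset (Finset.range_mono h) fun k _ hk => ?_
  rw [coeff_pow_eq_zero_of_lt hf (by simpa using hk), smul_zero]

theorem map_pexp {A B : Type*} [Ring A] [Algebra ℂ A] [Ring B] [Algebra ℂ B] (φ : A →ₐ[ℂ] B)
    (f : A⟦X⟧) :
    PowerSeries.map (φ : A →+* B) (pexp f) = pexp (PowerSeries.map (φ : A →+* B) f) := by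
  ext n
  simp only [pexp, PowerSeries.coeff_map, PowerSeries.coeff_mk, map_sum]
  refine Finset.sum_congr rfl fun k _ => ?_
  rw [← map_pow, PowerSeries.coeff_map]
  exact map_smul φ _ _

theorem constantCoeff_pexp {A : Type*} [Ring A] [Algebra ℂ A] (f : A⟦X⟧) :
    PowerSeries.constantCoeff (pexp f) = 1 := by
  rw [← PowerSeries.coeff_zero_eq_constantCoeff_apply]
  simp [pexp]

theorem pexp_zero : pexp (0 : A⟦X⟧) = 1 := by
  ext n
  simp only [pexp, PowerSeries.coeff_mk]
  rw [Finset.sum_eq_single 0]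
  · simp
  · intro k _ hk
    simp [hk]
  · simp

/-- Term by term, $(f^{k+1}/(k+1)!)'=f'f^k/k!$; the term $k=0$ is constant and drops out. This
differential equation replaces manipulations of double sums in what follows. -/
theorem derivative_pexp {f : A⟦X⟧} (hf : PowerSeries.constantCoeff f = 0) :
    PowerSeries.derivative A (pexp f) = PowerSeries.derivative A f * pexp f := by
  ext n
  have h1 : PowerSeries.coeff n (PowerSeries.derivative A f * pexp f) =
      ∑ k ∈ Finset.range (n + 1), ((k.factorial : ℂ)⁻¹) •
        PowerSeries.coeff n (PowerSeries.derivative A f * f ^ k) := by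
    simp only [PowerSeries.coeff_mul, Finset.smul_sum]
    rw [Finset.sum_comm]
    refine Finset.sum_congr rfl fun p hp => ?_
    have hp' : p.2 < n + 1 := by
      have := Finset.HasAntidiagonal.mem_antidiagonal.1 hp
      lia
    rw [coeff_pexp hf hp', Finset.mul_sum]
    exact Finset.sum_congr rfl fun k _ => mul_smul_comm _ _ _
  rw [h1, PowerSeries.coeff_derivative, coeff_pexp hf (Nat.lt_succ_self _), Finset.sum_mul,
    Finset.sum_range_succ']
  have h2 : PowerSeries.coeff (n + 1) (f ^ 0) = 0 := by
    simp [PowerSeries.coeff_one]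
  rw [h2, smul_zero, zero_mul, add_zero]
  refine Finset.sum_congr rfl fun k _ => ?_
  have h3 : PowerSeries.coeff (n + 1) (f ^ (k + 1)) * ((n : A) + 1) =
      ((k : ℂ) + 1) • PowerSeries.coeff n (PowerSeries.derivative A f * f ^ k) := by
    rw [← PowerSeries.coeff_derivative, PowerSeries.derivative_pow, add_tsub_cancel_right,
      mul_assoc, mul_comm (f ^ k), Algebra.smul_def]
    have h4 : (((k + 1 : ℕ) : A⟦X⟧)) = PowerSeries.C ((k + 1 : ℕ) : A) := by simp
    rw [h4, PowerSeries.coeff_C_mul]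
    simp
  rw [smul_mul_assoc, h3, smul_smul]
  congr 1
  rw [Nat.factorial_succ]
  have : ((k : ℂ) + 1) ≠ 0 := by exact_mod_cast Nat.succ_ne_zero k
  push_cast
  field_simp

/-- Without torsion, a power series is determined by its derivative and its constant coefficient. -/
theorem isAddTorsionFree_of_complex_algebra (A : Type*) [CommRing A] [Algebra ℂ A] :
    IsAddTorsionFree A where
  nsmul_right_injective n hn a b h := by
    have hn' : (n : ℂ) ≠ 0 := by exact_mod_cast hn
    have h1 : (n : ℂ) • a = (n : ℂ) • b := by
      rw [Nat.cast_smul_eq_nsmul, Nat.cast_smul_eq_nsmul]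
      exact h
    calc a = (n : ℂ)⁻¹ • (n : ℂ) • a := (inv_smul_smul₀ hn' a).symm
      _ = b := by rw [h1, inv_smul_smul₀ hn']

/-- `pexp f` is the only solution of `y' = f' y` with constant coefficient `1`. -/
theorem eq_of_derivative_eq_mul {f y z : A⟦X⟧} (hy : PowerSeries.derivative A y =
      PowerSeries.derivative A f * y) (hz : PowerSeries.derivative A z =
      PowerSeries.derivative A f * z) (hf : PowerSeries.constantCoeff f = 0)
    (h0 : PowerSeries.constantCoeff y = PowerSeries.constantCoeff z) : y = z := by
  have := isAddTorsionFree_of_complex_algebra A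
  have hneg : PowerSeries.constantCoeff (-f) = 0 := by rw [map_neg, hf, neg_zero]
  -- Integrating factor: `w * pexp (-f)` has zero derivative, hence is constant.
  have key : ∀ w : A⟦X⟧, PowerSeries.derivative A w = PowerSeries.derivative A f * w →
      w * pexp (-f) = PowerSeries.C (PowerSeries.constantCoeff w) := by
    intro w hw
    refine PowerSeries.derivative.ext ?_ ?_
    · rw [Derivation.leibniz, derivative_pexp hneg, hw, PowerSeries.derivative_C, map_neg]
      simp only [smul_eq_mul]
      ring
    · rw [map_mul, constantCoeff_pexp, PowerSeries.constantCoeff_C, mul_one]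
  have hu : IsUnit (pexp (-f)) := by
    rw [PowerSeries.isUnit_iff_constantCoeff, constantCoeff_pexp]
    exact isUnit_one
  exact hu.mul_right_cancel ((key y hy).trans (h0 ▸ (key z hz).symm))

theorem eq_pexp {f y : A⟦X⟧} (hf : PowerSeries.constantCoeff f = 0)
    (hy : PowerSeries.derivative A y = PowerSeries.derivative A f * y)
    (h0 : PowerSeries.constantCoeff y = 1) : y = pexp f :=
  eq_of_derivative_eq_mul hy (derivative_pexp hf) hf (h0.trans (constantCoeff_pexp f).symm)

/-- The product solves the equation $y'=(f+g)'y$ that characterizes the left side. -/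
theorem pexp_add {f g : A⟦X⟧} (hf : PowerSeries.constantCoeff f = 0)
    (hg : PowerSeries.constantCoeff g = 0) : pexp (f + g) = pexp f * pexp g := by
  refine (eq_pexp ?_ ?_ ?_).symm
  · rw [map_add, hf, hg, add_zero]
  · rw [Derivation.leibniz, derivative_pexp hf, derivative_pexp hg, map_add]
    simp only [smul_eq_mul]
    ring
  · rw [map_mul, constantCoeff_pexp, constantCoeff_pexp, one_mul]

/-- Compare logarithmic derivatives. This is what allows exponents to be read off coefficient by
coefficient. -/
theorem pexp_injective {f g : A⟦X⟧} (hf : PowerSeries.constantCoeff f = 0)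
    (hg : PowerSeries.constantCoeff g = 0) (h : pexp f = pexp g) : f = g := by
  have := isAddTorsionFree_of_complex_algebra A
  refine PowerSeries.derivative.ext ?_ (hf.trans hg.symm)
  have hu : IsUnit (pexp g) := by
    rw [PowerSeries.isUnit_iff_constantCoeff, constantCoeff_pexp]
    exact isUnit_one
  refine hu.mul_right_cancel ?_
  rw [← derivative_pexp hg, ← h, derivative_pexp hf]

theorem pexp_sum {ι : Type*} (s : Finset ι) {f : ι → A⟦X⟧}
    (hf : ∀ i ∈ s, PowerSeries.constantCoeff (f i) = 0) :
    pexp (∑ i ∈ s, f i) = ∏ i ∈ s, pexp (f i) := by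
  classical
  induction s using Finset.induction_on with
  | empty => exact pexp_zero
  | insert i s hi ih =>
    rw [Finset.sum_insert hi, Finset.prod_insert hi, pexp_add (hf i (Finset.mem_insert_self i s)),
      ih fun j hj => hf j (Finset.mem_insert_of_mem hj)]
    rw [map_sum]
    exact Finset.sum_eq_zero fun j hj => hf j (Finset.mem_insert_of_mem hj)

theorem pexp_nsmul {f : A⟦X⟧} (hf : PowerSeries.constantCoeff f = 0) (n : ℕ) :
    pexp (n • f) = pexp f ^ n := by
  have := pexp_sum (Finset.range n) (f := fun _ => f) fun _ _ => hf
  simpa using this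

theorem unit_zpow_eq_pexp {f : A⟦X⟧} (hf : PowerSeries.constantCoeff f = 0)
    (hu : IsUnit (pexp f)) (n : ℤ) :
    ((hu.unit ^ n : (A⟦X⟧)ˣ) : A⟦X⟧) = pexp (n • f) := by
  obtain ⟨m, rfl | rfl⟩ := n.eq_nat_or_neg
  · rw [zpow_natCast, Units.val_pow_eq_pow_val, IsUnit.unit_spec, natCast_zsmul, pexp_nsmul hf]
  · rw [zpow_neg, zpow_natCast, neg_smul, natCast_zsmul, Units.inv_eq_of_mul_eq_one_right]
    rw [Units.val_pow_eq_pow_val, IsUnit.unit_spec, ← pexp_nsmul hf, ← pexp_add]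
    · rw [add_neg_cancel, pexp_zero]
    all_goals simp [hf]

/-- `exp (-∑_{m ≥ 1} a ^ m X ^ m / m) = 1 - a X`. -/
theorem pexp_log_one_sub (a : ℂ) :
    pexp (posSeries fun m => -(a ^ m / m)) = 1 - PowerSeries.C a * PowerSeries.X := by
  refine (eq_pexp (constantCoeff_posSeries _) ?_ ?_).symm
  · have h1 : PowerSeries.derivative ℂ (posSeries fun m => -(a ^ m / m)) =
        -(PowerSeries.C a * PowerSeries.mk fun m => a ^ m) := by
      ext n
      have hn : ((n : ℂ) + 1) ≠ 0 := by exact_mod_cast Nat.succ_ne_zero n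
      rw [PowerSeries.coeff_derivative, coeff_posSeries _ n.succ_ne_zero, map_neg,
        PowerSeries.coeff_C_mul, PowerSeries.coeff_mk]
      rw [Nat.succ_eq_add_one, pow_succ']
      push_cast
      field_simp
    have h2 : (PowerSeries.mk fun m => a ^ m) * (1 - PowerSeries.C a * PowerSeries.X) = 1 := by
      ext n
      rw [mul_sub, mul_one, ← mul_assoc, mul_comm _ (PowerSeries.C a), mul_assoc]
      cases n with
      | zero => simp
      | succ n =>
        rw [map_sub, PowerSeries.coeff_C_mul, PowerSeries.coeff_succ_mul_X]
        simp [PowerSeries.coeff_one, pow_succ']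
    rw [h1, neg_mul, mul_assoc, h2, map_sub, Derivation.leibniz]
    simp
  · simp

end Pexp

/-! ### Polynomials of constant term `1` as formal exponentials -/

/-- The power sum `∑_a u_a a ^ m`. -/
def powerSum (u : ℂˣ →₀ ℤ) (m : ℕ) : ℂ := u.sum fun a n => (n : ℂ) * (a : ℂ) ^ m

theorem powerSum_sub (u v : ℂˣ →₀ ℤ) (m : ℕ) :
    powerSum (u - v) m = powerSum u m - powerSum v m :=
  Finsupp.sum_sub_index fun _ _ _ => by push_cast; ring

theorem ne_zero_of_mem_roots {Q : ℂ[X]} (h0 : Q.coeff 0 = 1) {x : ℂ} (hx : x ∈ Q.roots) :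
    x ≠ 0 := by
  rintro rfl
  have h1 := Polynomial.isRoot_of_mem_roots hx
  rw [Polynomial.IsRoot, ← Polynomial.coeff_zero_eq_eval_zero, h0] at h1
  exact one_ne_zero h1

/-- A factor $1-ua$ is indexed by $a$, the inverse of the root; the constant term $1$ excludes the
root $0$, so every root is counted. -/
theorem powerSum_factorExp {Q : ℂ[X]} (h0 : Q.coeff 0 = 1) (m : ℕ) :
    powerSum (factorExp Q) m = (Q.roots.map fun x => (x⁻¹) ^ m).sum := by
  classical
  rw [Finset.sum_multiset_map_count]
  unfold powerSum Finsupp.sum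
  have hval : ∀ a : ℂˣ, factorExp Q a = (Q.roots.count ((a⁻¹ : ℂˣ) : ℂ) : ℤ) := fun a => by
    rw [Polynomial.count_roots]
    rfl
  refine Finset.sum_bij (fun a _ => ((a⁻¹ : ℂˣ) : ℂ)) ?_ ?_ ?_ ?_
  · intro a ha
    have h2 := Finsupp.mem_support_iff.1 ha
    rw [hval] at h2
    rw [Multiset.mem_toFinset]
    exact Multiset.count_ne_zero.1 (by exact_mod_cast h2)
  · intro a _ b _ hab
    exact inv_injective (Units.val_injective hab)
  · intro x hx
    rw [Multiset.mem_toFinset] at hx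
    refine ⟨(Units.mk0 x (ne_zero_of_mem_roots h0 hx))⁻¹, ?_, by simp⟩
    rw [Finsupp.mem_support_iff, hval, inv_inv, Units.val_mk0]
    exact_mod_cast Multiset.count_ne_zero.2 hx
  · intro a _
    rw [hval]
    simp

/-- Write $X-x=-x(1-x^{-1}X)$ for each root; evaluation at $0$ shows that the collected scalar,
leading coefficient included, is $1$. -/
theorem eq_prod_one_sub {Q : ℂ[X]} (h0 : Q.coeff 0 = 1) :
    Q = (Q.roots.map fun x => 1 - Polynomial.C x⁻¹ * Polynomial.X).prod := by
  have h1 : (Q.roots.map fun x => Polynomial.X - Polynomial.C x).prod =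
      Polynomial.C (Q.roots.map fun x => -x).prod *
        (Q.roots.map fun x => 1 - Polynomial.C x⁻¹ * Polynomial.X).prod := by
    rw [← Multiset.prod_hom, Multiset.map_map, ← Multiset.prod_map_mul]
    refine congrArg _ (Multiset.map_congr rfl fun x hx => ?_)
    have hx0 := ne_zero_of_mem_roots h0 hx
    have h2 : Polynomial.C x * Polynomial.C x⁻¹ = 1 := by
      rw [← Polynomial.C_mul, mul_inv_cancel₀ hx0, Polynomial.C_1]
    simp only [Function.comp_apply, map_neg]
    linear_combination (-Polynomial.X) * h2
  have h2 := (IsAlgClosed.splits Q).eq_prod_roots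
  rw [h1, ← mul_assoc, ← Polynomial.C_mul] at h2
  have h3 : (Q.roots.map fun x => 1 - Polynomial.C x⁻¹ * Polynomial.X).prod.eval 0 = 1 := by
    rw [Polynomial.eval_multiset_prod, Multiset.map_map]
    simp
  have h4 := congrArg (Polynomial.eval 0) h2
  rw [Polynomial.eval_mul, h3, ← Polynomial.coeff_zero_eq_eval_zero, h0, Polynomial.eval_C,
    mul_one] at h4
  rwa [← h4, Polynomial.C_1, one_mul] at h2

theorem coe_comp_C_mul_X_eq_pexp {Q : ℂ[X]} (h0 : Q.coeff 0 = 1) (c : ℂ) :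
    ((Q.comp (Polynomial.C c * Polynomial.X) : ℂ[X]) : ℂ⟦X⟧) =
      pexp (posSeries fun m => -(c ^ m * powerSum (factorExp Q) m / m)) := by
  -- An arbitrary multiset replaces `Q.roots`, so that the induction can add one linear factor at a
  -- time through `pexp_log_one_sub`.
  have key : ∀ s : Multiset ℂ,
      ((((s.map fun x => 1 - Polynomial.C x⁻¹ * Polynomial.X).prod.comp
        (Polynomial.C c * Polynomial.X) : ℂ[X])) : ℂ⟦X⟧) =
      pexp (posSeries fun m => -(c ^ m * (s.map fun x => (x⁻¹) ^ m).sum / m)) := by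
    intro s
    induction s using Multiset.induction_on with
    | empty =>
      have : (posSeries fun m : ℕ => -(c ^ m * ((0 : Multiset ℂ).map fun x => (x⁻¹) ^ m).sum / m))
          = 0 := by
        ext m
        simp [posSeries]
      rw [this, pexp_zero]
      simp
    | cons x s ih =>
      have : (posSeries fun m : ℕ => -(c ^ m * ((x ::ₘ s).map fun x => (x⁻¹) ^ m).sum / m)) =
          (posSeries fun m => -((x⁻¹ * c) ^ m / m)) +
          posSeries fun m => -(c ^ m * (s.map fun x => (x⁻¹) ^ m).sum / m) := by
        ext m
        simp only [posSeries, PowerSeries.coeff_mk, map_add, Multiset.map_cons, Multiset.sum_cons]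
        split_ifs
        · simp
        · ring
      rw [this, pexp_add (constantCoeff_posSeries _) (constantCoeff_posSeries _), ← ih,
        pexp_log_one_sub, Multiset.map_cons, Multiset.prod_cons, Polynomial.mul_comp,
        Polynomial.coe_mul]
      congr 1
      simp [mul_assoc]
  simp only [powerSum_factorExp h0, ← key]
  rw [← eq_prod_one_sub h0]

/-- The logarithm of `Q(c⁻¹ X) P(c X) / (Q(c X) P(c⁻¹ X))`. -/
theorem eq_of_pexp_mul_eq {Q P : ℂ[X]} (hQ : Q.coeff 0 = 1) (hP : P.coeff 0 = 1) {c : ℂ}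
    {b : ℕ → ℂ}
    (h : pexp (posSeries b) * (((Q.comp (Polynomial.C c * Polynomial.X) *
        P.comp (Polynomial.C c⁻¹ * Polynomial.X) : ℂ[X])) : ℂ⟦X⟧) =
      ((Q.comp (Polynomial.C c⁻¹ * Polynomial.X) *
        P.comp (Polynomial.C c * Polynomial.X) : ℂ[X]) : ℂ⟦X⟧)) {m : ℕ} (hm : m ≠ 0) :
    b m = (c ^ m - (c⁻¹) ^ m) * powerSum (factorExp Q - factorExp P) m / m := by
  have h0 := fun d : ℕ → ℂ => constantCoeff_posSeries d
  simp only [Polynomial.coe_mul, coe_comp_C_mul_X_eq_pexp hQ, coe_comp_C_mul_X_eq_pexp hP] at h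
  rw [← pexp_add (h0 _) (h0 _), ← pexp_add (h0 _) (h0 _), ← pexp_add (h0 _) (by simp [h0])] at h
  have h1 := congrArg (PowerSeries.coeff m)
    (pexp_injective (by simp [h0]) (by simp [h0]) h)
  simp only [map_add, coeff_posSeries _ hm] at h1
  rw [powerSum_sub]
  linear_combination h1

/-! ### Simultaneous generalized eigenspaces -/

section Eigenspaces

open Module.End

variable {V : Type*} [AddCommGroup V] [Module ℂ V]

theorem mem_maxGenEigenspace_add {f g : Module.End ℂ V} (h : Commute f g) {a b : ℂ} {v : V}
    (hf : v ∈ f.maxGenEigenspace a) (hg : v ∈ g.maxGenEigenspace b) :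
    v ∈ (f + g).maxGenEigenspace (a + b) :=
  genEigenspace_inf_le_add f g a b ⊤ ⊤ h ⟨hf, hg⟩

theorem mem_maxGenEigenspace_algebraMap (a : ℂ) (v : V) :
    v ∈ (algebraMap ℂ (Module.End ℂ V) a).maxGenEigenspace a := by
  rw [mem_maxGenEigenspace]
  exact ⟨1, by simp [Module.algebraMap_end_apply]⟩

theorem mem_maxGenEigenspace_mul_zero {f g : Module.End ℂ V} (h : Commute f g) {v : V}
    (hf : v ∈ f.maxGenEigenspace 0) : v ∈ (g * f).maxGenEigenspace 0 := by
  rw [mem_maxGenEigenspace] at hf ⊢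
  obtain ⟨k, hk⟩ := hf
  refine ⟨k, ?_⟩
  rw [zero_smul, sub_zero] at hk ⊢
  rw [h.symm.mul_pow, Module.End.mul_apply, hk, map_zero]

theorem mem_maxGenEigenspace_sub_algebraMap {f : Module.End ℂ V} {a : ℂ} {v : V}
    (hf : v ∈ f.maxGenEigenspace a) :
    v ∈ (f - algebraMap ℂ _ a).maxGenEigenspace 0 := by
  have h := mem_maxGenEigenspace_add (Algebra.commute_algebraMap_right (-a) f) hf
    (mem_maxGenEigenspace_algebraMap (-a) v)
  rwa [map_neg, ← sub_eq_add_neg, add_neg_cancel] at h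

/-- With the additive version, this makes joint generalized eigenvalues multiplicative and additive
in the operator, hence characters. -/
theorem mem_maxGenEigenspace_mul {f g : Module.End ℂ V} (h : Commute f g) {a b : ℂ} {v : V}
    (hf : v ∈ f.maxGenEigenspace a) (hg : v ∈ g.maxGenEigenspace b) :
    v ∈ (f * g).maxGenEigenspace (a * b) := by
  have hca (x : Module.End ℂ V) : Commute x (algebraMap ℂ _ a) :=
    Algebra.commute_algebraMap_right a x
  have hcb (x : Module.End ℂ V) : Commute x (algebraMap ℂ _ b) :=
    Algebra.commute_algebraMap_right b x
  have h1 := mem_maxGenEigenspace_mul_zero (g := g) (h.sub_left (hca g).symm)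
    (mem_maxGenEigenspace_sub_algebraMap hf)
  have h2 := mem_maxGenEigenspace_mul_zero (g := algebraMap ℂ _ a) (hca _)
    (mem_maxGenEigenspace_sub_algebraMap hg)
  -- The first two terms have generalized eigenvalue $0$ at `v`, since $f-a$ and $g-b$ do, and
  -- everything commutes; only the scalar $ab$ remains.
  have h3 : f * g = g * (f - algebraMap ℂ _ a) +
      (algebraMap ℂ _ a * (g - algebraMap ℂ _ b) + algebraMap ℂ _ (a * b)) := by
    rw [map_mul, mul_sub, mul_sub, h.eq, (hca g).eq]
    abel
  have hfg : Commute g (f - algebraMap ℂ _ a) := h.symm.sub_right (hca g)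
  have hfg' : Commute g (g - algebraMap ℂ _ b) := (Commute.refl g).sub_right (hcb g)
  have h4 := mem_maxGenEigenspace_add (Algebra.commute_algebraMap_right (a * b) _) h2
    (mem_maxGenEigenspace_algebraMap (a * b) v)
  have h5 : Commute (g * (f - algebraMap ℂ (Module.End ℂ V) a))
      (algebraMap ℂ _ a * (g - algebraMap ℂ _ b) + algebraMap ℂ _ (a * b)) :=
    (((hca _).mul_right (Commute.mul_left hfg' (((h.sub_left (hca g).symm)).sub_right
      (hcb _))))).add_right (Algebra.commute_algebraMap_right _ _)
  have h6 := mem_maxGenEigenspace_add h5 h1 h4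
  rwa [← h3, zero_add, zero_add] at h6

theorem eq_of_mem_maxGenEigenspace {f : Module.End ℂ V} {a b : ℂ} {v : V} (hv : v ≠ 0)
    (ha : v ∈ f.maxGenEigenspace a) (hb : v ∈ f.maxGenEigenspace b) : a = b := by
  by_contra hab
  exact hv ((Submodule.disjoint_def.1 (disjoint_genEigenspace f hab ⊤ ⊤)) v ha hb)

/-- If submodules `a x`, spanning the module, are contained in members `b (f x)` of an independent
family, then they are these members, and the other members vanish. -/
theorem eq_of_le_of_iSupIndep {X Y : Type*} {a : X → Submodule ℂ V} {b : Y → Submodule ℂ V}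
    {f : X → Y} (hf : Function.Injective f) (hab : ∀ x, a x ≤ b (f x)) (hb : iSupIndep b)
    (ha : ⨆ x, a x = ⊤) : (∀ x, a x = b (f x)) ∧ ∀ y, y ∉ Set.range f → b y = ⊥ := by
  constructor
  · intro x
    refine le_antisymm (hab x) fun v hv => ?_
    -- In the resulting splitting of `v`, the second component lies both in `b (f x)` and in the sum
    -- of the other members, so independence kills it.
    have h1 : (⊤ : Submodule ℂ V) ≤ a x ⊔ ⨆ y, ⨆ (_ : y ≠ f x), b y := by
      rw [← ha]
      refine iSup_le fun x' => ?_
      by_cases h : x' = x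
      · rw [h]; exact le_sup_left
      · exact le_sup_of_le_right ((hab x').trans
          (le_iSup₂_of_le (f x') (fun h' => h (hf h')) le_rfl))
    obtain ⟨y, hy, z, hz, rfl⟩ := Submodule.mem_sup.1 (h1 (Submodule.mem_top : v ∈ ⊤))
    have h2 : z ∈ b (f x) := by simpa using sub_mem hv (hab x hy)
    rw [Submodule.disjoint_def.1 (hb (f x)) z h2 hz, add_zero]
    exact hy
  · intro y hy
    have h1 : (⊤ : Submodule ℂ V) ≤ ⨆ y', ⨆ (_ : y' ≠ y), b y' := by
      rw [← ha]
      exact iSup_le fun x => (hab x).trans (le_iSup₂_of_le (f x) (fun h => hy ⟨x, h⟩) le_rfl)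
    have h2 := (hb y).mono_right h1
    rwa [disjoint_top] at h2

/-- On each summand `f` differs from the scalar `μ x` by a nilpotent operator, which has trace $0$.
-/
theorem trace_eq_sum_of_le_maxGenEigenspace [FiniteDimensional ℂ V] {X : Type*} [Fintype X]
    [DecidableEq X] {N : X → Submodule ℂ V} (hN : DirectSum.IsInternal N) {f : Module.End ℂ V}
    (hf : ∀ x, Set.MapsTo f (N x) (N x)) {μ : X → ℂ}
    (hμ : ∀ x, N x ≤ f.maxGenEigenspace (μ x)) :
    LinearMap.trace ℂ V f = ∑ x, (Module.finrank ℂ (N x) : ℂ) * μ x := by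
  rw [LinearMap.trace_eq_sum_trace_restrict hN hf]
  refine Finset.sum_congr rfl fun x _ => ?_
  have h1 : IsNilpotent (f.restrict (hf x) - algebraMap ℂ (Module.End ℂ (N x)) (μ x)) := by
    rw [Module.End.isNilpotent_iff_of_finite]
    intro v
    obtain ⟨k, hk⟩ := (mem_maxGenEigenspace _ _ _).1 (hμ x v.2)
    refine ⟨k, Subtype.ext ?_⟩
    have h2 : ∀ (j : ℕ) (w : N x),
        ((((f.restrict (hf x) - algebraMap ℂ (Module.End ℂ (N x)) (μ x)) ^ j) w : N x) : V) =
        ((f - μ x • (1 : Module.End ℂ V)) ^ j) (w : V) := by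
      intro j
      induction j with
      | zero => simp
      | succ j ih =>
        intro w
        rw [pow_succ, pow_succ, Module.End.mul_apply, Module.End.mul_apply, ih]
        simp [Module.algebraMap_end_apply]
        rfl
    rw [h2, hk]
    rfl
  have h3 := (LinearMap.isNilpotent_trace_of_isNilpotent h1).eq_zero
  rw [map_sub, sub_eq_zero, Algebra.algebraMap_eq_smul_one, map_smul, LinearMap.trace_one,
    smul_eq_mul] at h3
  rw [h3, mul_comm]

end Eigenspaces

/-! ### Structure of `U_q(ĥ)` -/

section UqLemmas

variable {I : Type*} {H : Type*} [AddCommGroup H]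

theorem Uq.k_mul_k (a b : H) : Uq.k I a * Uq.k I b = Uq.k I (a + b) := by
  unfold Uq.k
  rw [← map_mul]
  exact RingQuot.mkAlgHom_rel ℂ (Rel.k_mul a b)

theorem Uq.induction {p : Uq I H → Prop} (hc : ∀ c : ℂ, p (algebraMap ℂ _ c))
    (hk : ∀ w, p (Uq.k I w)) (hh : ∀ i m, p (Uq.h H i m))
    (hadd : ∀ a b, p a → p b → p (a + b)) (hmul : ∀ a b, p a → p b → p (a * b)) (u : Uq I H) :
    p u := by
  obtain ⟨x, rfl⟩ := RingQuot.mkAlgHom_surjective ℂ (Rel I H) u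
  induction x using FreeAlgebra.induction with
  | grade0 c => rw [AlgHom.commutes]; exact hc c
  | grade1 x =>
    cases x with
    | k w => exact hk w
    | h i m =>
      have := hh i m.1
      rwa [Uq.h, dif_pos m.2] at this
  | mul a b ha hb => rw [map_mul]; exact hmul _ _ ha hb
  | add a b ha hb => rw [map_add]; exact hadd _ _ ha hb

theorem Uq.commute (a b : Uq I H) : Commute a b := by
  induction a using Uq.induction with
  | hc c => exact Algebra.commute_algebraMap_left c b
  | hadd a a' ha ha' => exact ha.add_left ha'
  | hmul a a' ha ha' => exact ha.mul_left ha'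
  | hk w =>
    induction b using Uq.induction with
    | hc c => exact Algebra.commute_algebraMap_right c _
    | hadd a a' ha ha' => exact ha.add_right ha'
    | hmul a a' ha ha' => exact ha.mul_right ha'
    | hk w' => rw [commute_iff_eq, Uq.k_mul_k, Uq.k_mul_k, add_comm]
    | hh i m => exact Uq.k_mul_h w i m
  | hh i m =>
    induction b using Uq.induction with
    | hc c => exact Algebra.commute_algebraMap_right c _
    | hadd a a' ha ha' => exact ha.add_right ha'
    | hmul a a' ha ha' => exact ha.mul_right ha'
    | hk w => exact (Uq.k_mul_h w i m).symm
    | hh j l => exact Uq.h_mul_h i j m l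

theorem Uq.algHom_ext {B : Type*} [Semiring B] [Algebra ℂ B] {f g : Uq I H →ₐ[ℂ] B}
    (hk : ∀ w, f (Uq.k I w) = g (Uq.k I w)) (hh : ∀ i m, f (Uq.h H i m) = g (Uq.h H i m)) :
    f = g := by
  refine AlgHom.ext fun u => ?_
  induction u using Uq.induction with
  | hc c => simp
  | hadd a a' ha ha' => rw [map_add, map_add, ha, ha']
  | hmul a a' ha ha' => rw [map_mul, map_mul, ha, ha']
  | hk w => exact hk w
  | hh i m => exact hh i m

end UqLemmas

/-! ### Decomposition of a module into `l`-weight spaces -/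

section Decomposition

open Module.End

variable {I : Type*} [Fintype I] {A : CartanDatum I} {H : Type*} [AddCommGroup H] [Module ℚ H]
variable (V : Type*) [AddCommGroup V] [Module ℂ V] [Module (Uq I H) V] [IsScalarTower ℂ (Uq I H) V]

theorem act_commute (a b : Uq I H) : Commute (act V a) (act V b) := (Uq.commute a b).map (act V)

/-- The family is arbitrary because three are needed: all of $\mathcal U_q(\hat{\mathfrak h})$, the
$k_\omega$ alone, and the $k_\omega$ together with the $\phi^\pm_{i,\pm m}$. -/
theorem independent_iInf_maxGenEigenspace_act {T : Type*} (u : T → Uq I H) :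
    iSupIndep fun c : T → ℂ => ⨅ t, (act V (u t)).maxGenEigenspace (c t) :=
  independent_iInf_maxGenEigenspace_of_forall_mapsTo _ fun i j φ =>
    mapsTo_maxGenEigenspace_of_comm (act_commute V (u j) (u i)) φ

/-- The simultaneous generalized eigenspace of all elements of `U_q(ĥ)`. -/
def charSpace (χ : Uq I H → ℂ) : Submodule ℂ V := ⨅ u, (act V u).maxGenEigenspace (χ u)

variable {V}

theorem mem_charSpace {χ : Uq I H → ℂ} {v : V} :
    v ∈ charSpace V χ ↔ ∀ u, v ∈ (act V u).maxGenEigenspace (χ u) := by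
  simp [charSpace, Submodule.mem_iInf]

theorem mapsTo_charSpace {g : Module.End ℂ V} (hg : ∀ u : Uq I H, Commute (act V u) g)
    (χ : Uq I H → ℂ) : Set.MapsTo g (charSpace V χ) (charSpace V χ) := fun _ hv =>
  mem_charSpace.2 fun u => mapsTo_maxGenEigenspace_of_comm (hg u) (χ u) (mem_charSpace.1 hv u)

/-- A nonzero common vector has only one generalized eigenvalue for each operator, so the rules for
sums and products force `χ` to respect them. -/
theorem exists_algHom_of_charSpace_ne_bot {χ : Uq I H → ℂ} (h : charSpace V χ ≠ ⊥) :
    ∃ χ' : Uq I H →ₐ[ℂ] ℂ, ⇑χ' = χ := by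
  obtain ⟨v, hv, hv0⟩ := Submodule.exists_mem_ne_zero_of_ne_bot h
  rw [mem_charSpace] at hv
  have hC : ∀ c : ℂ, χ (algebraMap ℂ _ c) = c := fun c => by
    have h1 := hv (algebraMap ℂ _ c)
    rw [AlgHom.commutes] at h1
    exact eq_of_mem_maxGenEigenspace hv0 h1 (mem_maxGenEigenspace_algebraMap c v)
  have hadd : ∀ a b, χ (a + b) = χ a + χ b := fun a b => by
    refine eq_of_mem_maxGenEigenspace hv0 (hv (a + b)) ?_
    rw [map_add]
    exact mem_maxGenEigenspace_add (act_commute V a b) (hv a) (hv b)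
  have hmul : ∀ a b, χ (a * b) = χ a * χ b := fun a b => by
    refine eq_of_mem_maxGenEigenspace hv0 (hv (a * b)) ?_
    rw [map_mul]
    exact mem_maxGenEigenspace_mul (act_commute V a b) (hv a) (hv b)
  exact ⟨{ toFun := χ
           map_one' := by simpa using hC 1
           map_zero' := by simpa using hC 0
           map_add' := hadd
           map_mul' := hmul
           commutes' := hC }, rfl⟩

variable (I H V) in
/-- The characters of `U_q(ĥ)` that occur in `V`. -/
abbrev Chars : Type _ := {χ : Uq I H →ₐ[ℂ] ℂ // charSpace V χ ≠ ⊥}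

theorem iSupIndep_charSpace : iSupIndep fun χ : Chars I H V => charSpace V χ.1 :=
  (independent_iInf_maxGenEigenspace_act V (fun u : Uq I H => u)).comp
    (f := fun χ : Chars I H V => (χ.1 : Uq I H → ℂ))
    fun _ _ h => Subtype.ext (DFunLike.coe_injective h)

theorem iSup_charSpace [FiniteDimensional ℂ V] :
    ⨆ χ : Chars I H V, charSpace V χ.1 = ⊤ := by
  have h1 : ⨆ χ : Uq I H → ℂ, charSpace V χ = ⊤ :=
    iSup_iInf_maxGenEigenspace_eq_top_of_forall_mapsTo (fun u : Uq I H => act V u)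
      (fun a b φ => mapsTo_maxGenEigenspace_of_comm (act_commute V b a) φ)
      fun a => iSup_maxGenEigenspace_eq_top (act V a)
  rw [eq_top_iff, ← h1]
  refine iSup_le fun χ => ?_
  by_cases h : charSpace V χ = ⊥
  · rw [h]; exact bot_le
  · obtain ⟨χ', rfl⟩ := exists_algHom_of_charSpace_ne_bot h
    exact le_iSup (fun χ : Chars I H V => charSpace V χ.1) ⟨χ', h⟩

instance [FiniteDimensional ℂ V] : Finite (Chars I H V) :=
  WellFoundedGT.finite_of_iSupIndep iSupIndep_charSpace fun χ => χ.2

open Classical in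
theorem isInternal_charSpace [FiniteDimensional ℂ V] :
    DirectSum.IsInternal fun χ : Chars I H V => charSpace V χ.1 :=
  (DirectSum.isInternal_submodule_iff_iSupIndep_and_iSup_eq_top _).2
    ⟨iSupIndep_charSpace, iSup_charSpace⟩

variable {τ : ℂ}

theorem mem_weightSpace_iff {lam : Module.Dual ℚ H} {v : V} :
    v ∈ weightSpace I V τ lam ↔ ∀ w : H, act V (Uq.k I w) v = qpow τ (lam w) • v := Iff.rfl

/-- The weight spaces span `V` and sit inside the joint generalized eigenspaces of the $k_\omega$,
so they coincide with them and no other eigenvalue families occur. A nonzero character space lies in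
one of these. -/
theorem exists_weight (hq : NotRootOfUnity τ) (hV : IsDiagonalizable I H V τ)
    (χ : Chars I H V) : ∃ lam : Module.Dual ℚ H, charSpace V χ.1 ≤ weightSpace I V τ lam ∧
      ∀ w, χ.1 (Uq.k I w) = qpow τ (lam w) := by
  classical
  obtain ⟨h1, h2⟩ := eq_of_le_of_iSupIndep (a := fun lam : Module.Dual ℚ H => weightSpace I V τ lam)
    (b := fun c : H → ℂ => ⨅ w, (act V (Uq.k I w)).maxGenEigenspace (c w))
    (f := fun lam w => qpow τ (lam w))
    (fun lam mu h => LinearMap.ext fun w => qpow_injective hq (congrFun h w))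
    (fun lam v hv => by
      rw [Submodule.mem_iInf]
      intro w
      rw [mem_maxGenEigenspace]
      refine ⟨1, ?_⟩
      have := mem_weightSpace_iff.1 hv w
      rw [pow_one, LinearMap.sub_apply, this]
      simp)
    (independent_iInf_maxGenEigenspace_act V fun w => Uq.k I w)
    (DirectSum.IsInternal.submodule_iSup_eq_top hV)
  have h3 : charSpace V χ.1 ≤
      ⨅ w, (act V (Uq.k I w)).maxGenEigenspace (χ.1 (Uq.k I w)) :=
    le_iInf fun w => iInf_le _ _
  by_cases h4 : (fun w => χ.1 (Uq.k I w)) ∈ Set.range fun (lam : Module.Dual ℚ H) w =>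
      qpow τ (lam w)
  · obtain ⟨lam, hlam⟩ := h4
    refine ⟨lam, ?_, fun w => (congrFun hlam w).symm⟩
    have hl : ∀ w, qpow τ (lam w) = χ.1 (Uq.k I w) := congrFun hlam
    rw [h1 lam]
    simpa only [hl] using h3
  · exact absurd (le_bot_iff.1 (h3.trans (h2 _ h4).le)) χ.2

/-- The weight of a character of `U_q(ĥ)` that occurs in `V`. -/
def charWeight (hq : NotRootOfUnity τ) (hV : IsDiagonalizable I H V τ) (χ : Chars I H V) :
    Module.Dual ℚ H := (exists_weight hq hV χ).choose

theorem charSpace_le_weightSpace (hq : NotRootOfUnity τ) (hV : IsDiagonalizable I H V τ)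
    (χ : Chars I H V) : charSpace V χ.1 ≤ weightSpace I V τ (charWeight hq hV χ) :=
  (exists_weight hq hV χ).choose_spec.1

theorem char_k (hq : NotRootOfUnity τ) (hV : IsDiagonalizable I H V τ)
    (χ : Chars I H V) (w : H) : χ.1 (Uq.k I w) = qpow τ (charWeight hq hV χ w) :=
  (exists_weight hq hV χ).choose_spec.2 w

theorem map_phi (R : Realization A H) (χ : Uq I H →ₐ[ℂ] ℂ) (s : ℤˣ) (i : I) :
    PowerSeries.map (χ : Uq I H →+* ℂ) (phi R τ s i) =
      PowerSeries.C (χ (Uq.k I (((s : ℤ) * (A.r i : ℚ)) • R.coroot i))) *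
        pexp (posSeries fun m =>
          (((s : ℤ) : ℂ) * (qpow τ 1 - qpow τ (-1))) * χ (Uq.h H i ((s : ℤ) * (m : ℤ)))) := by
  rw [phi, map_mul, PowerSeries.map_C, map_pexp, map_posSeries]
  simp

/-- The `l`-weight of a character of `U_q(ĥ)` that occurs in `V`. -/
def charLWeight (R : Realization A H) (hq : NotRootOfUnity τ) (hV : IsDiagonalizable I H V τ)
    (χ : Chars I H V) : LWeight R τ where
  wt := charWeight hq hV χ
  Psi s i m := χ.1 (PowerSeries.coeff m (phi R τ s i))
  compat s i := by
    have h1 := congrArg (PowerSeries.coeff 0) (map_phi (τ := τ) R χ.1 s i)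
    rw [PowerSeries.coeff_map, PowerSeries.coeff_C_mul,
      PowerSeries.coeff_zero_eq_constantCoeff_apply (pexp _), constantCoeff_pexp, mul_one,
      char_k hq hV, map_smul] at h1
    rw [← mul_assoc]
    exact h1

theorem mk_Psi_charLWeight (R : Realization A H) (hq : NotRootOfUnity τ)
    (hV : IsDiagonalizable I H V τ) (χ : Chars I H V) (s : ℤˣ) (i : I) :
    PowerSeries.mk ((charLWeight R hq hV χ).Psi s i) =
      PowerSeries.C ((charLWeight R hq hV χ).Psi s i 0) *
        pexp (posSeries fun m =>
          (((s : ℤ) : ℂ) * (qpow τ 1 - qpow τ (-1))) * χ.1 (Uq.h H i ((s : ℤ) * (m : ℤ)))) := by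
  have h1 : PowerSeries.mk ((charLWeight R hq hV χ).Psi s i) =
      PowerSeries.map (χ.1 : Uq I H →+* ℂ) (phi R τ s i) := by
    ext m
    rw [PowerSeries.coeff_map, PowerSeries.coeff_mk]
    rfl
  rw [h1, map_phi, LWeight.compat, char_k hq hV, map_smul, smul_eq_mul, mul_assoc]
  rfl

theorem qpow_one_sub_ne_zero (hq : NotRootOfUnity τ) : qpow τ 1 - qpow τ (-1) ≠ 0 := by
  intro h
  have := qpow_injective hq (sub_eq_zero.1 h)
  norm_num at this

/-- The weight gives back the values at $k_\omega$; the logarithm of each series $\Psi$ gives back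
the values at $h_{i,m}$, because $q\neq q^{-1}$. -/
theorem charLWeight_injective (R : Realization A H) (hq : NotRootOfUnity τ)
    (hV : IsDiagonalizable I H V τ) : Function.Injective (charLWeight (V := V) R hq hV) := by
  intro χ χ' h
  refine Subtype.ext (Uq.algHom_ext (fun w => ?_) fun i m => ?_)
  · have h1 : charWeight hq hV χ = charWeight hq hV χ' := congrArg LWeight.wt h
    rw [char_k hq hV, char_k hq hV, h1]
  · by_cases hm : m = 0
    -- At $m=0$ both values come from the default $0$ of `Uq.h`.
    · simp [hm, Uq.h]
    obtain ⟨s, n, hn, rfl⟩ : ∃ (s : ℤˣ) (n : ℕ), n ≠ 0 ∧ m = (s : ℤ) * (n : ℤ) := by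
      rcases Int.natAbs_eq m with h' | h'
      · exact ⟨1, m.natAbs, by simpa using hm, by simpa using h'⟩
      · exact ⟨-1, m.natAbs, by simpa using hm, by simpa using h'⟩
    have h1 := mk_Psi_charLWeight R hq hV χ s i
    rw [h, mk_Psi_charLWeight R hq hV χ' s i] at h1
    have h2 : IsUnit (PowerSeries.C ((charLWeight R hq hV χ').Psi s i 0)) := by
      rw [LWeight.compat]
      exact (IsUnit.mk0 _ (Complex.exp_ne_zero _)).map PowerSeries.C
    have h3 := congrArg (PowerSeries.coeff n) (pexp_injective (constantCoeff_posSeries _)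
      (constantCoeff_posSeries _) (h2.mul_left_cancel h1))
    rw [coeff_posSeries _ hn, coeff_posSeries _ hn] at h3
    have h4 : ((s : ℤ) : ℂ) ≠ 0 := by exact_mod_cast s.ne_zero
    exact (mul_left_cancel₀ (mul_ne_zero h4 (qpow_one_sub_ne_zero hq)) h3).symm

theorem charSpace_le_lWeightSpace [FiniteDimensional ℂ V] (R : Realization A H)
    (hq : NotRootOfUnity τ) (hV : IsDiagonalizable I H V τ) (χ : Chars I H V) :
    charSpace V χ.1 ≤ lWeightSpace V (charLWeight R hq hV χ) := by
  intro v hv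
  -- One exponent must serve all `s`, `i`, `m` at once; $\dim V$ bounds every nilpotency index.
  refine ⟨charSpace_le_weightSpace hq hV χ hv, Module.finrank ℂ V, fun s i m => ?_⟩
  have h1 := mem_charSpace.1 hv (PowerSeries.coeff m (phi R τ s i))
  rw [maxGenEigenspace_eq_genEigenspace_finrank, mem_genEigenspace_nat, LinearMap.mem_ker,
    ← Algebra.algebraMap_eq_smul_one] at h1
  exact h1

/-- The $k_\omega$ are used alongside the $\phi^\pm_{i,\pm m}$ because `Psi` sees the weight only on
the coroots, which need not span $\mathfrak h$. -/
theorem iSupIndep_lWeightSpace (R : Realization A H) (hq : NotRootOfUnity τ) :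
    iSupIndep fun Γ : LWeight R τ => lWeightSpace V Γ := by
  have h1 := (independent_iInf_maxGenEigenspace_act V
    (Sum.elim (fun w : H => Uq.k I w)
      fun p : ℤˣ × I × ℕ => PowerSeries.coeff p.2.2 (phi R τ p.1 p.2.1))).comp
    (f := fun Γ : LWeight R τ => Sum.elim (fun w => qpow τ (Γ.wt w))
      fun p => Γ.Psi p.1 p.2.1 p.2.2) (fun Γ Γ' h => by
        refine LWeight.ext (LinearMap.ext fun w => qpow_injective hq (congrFun h (Sum.inl w))) ?_
        funext s i m
        exact congrFun h (Sum.inr (s, i, m)))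
  refine h1.mono fun Γ v hv => ?_
  obtain ⟨hv1, p, hp⟩ := hv
  simp only [Function.comp_apply]
  rw [Submodule.mem_iInf]
  rintro (w | ⟨s, i, m⟩) <;> rw [mem_maxGenEigenspace]
  · refine ⟨1, ?_⟩
    have := mem_weightSpace_iff.1 hv1 w
    rw [pow_one, LinearMap.sub_apply, Sum.elim_inl, this]
    simp
  · exact ⟨p, by rw [← Algebra.algebraMap_eq_smul_one]; exact hp s i m⟩

theorem lWeightSpace_charLWeight [FiniteDimensional ℂ V] (R : Realization A H)
    (hq : NotRootOfUnity τ) (hV : IsDiagonalizable I H V τ) (χ : Chars I H V) :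
    lWeightSpace V (charLWeight R hq hV χ) = charSpace V χ.1 :=
  ((eq_of_le_of_iSupIndep (charLWeight_injective R hq hV) (charSpace_le_lWeightSpace R hq hV)
    (iSupIndep_lWeightSpace R hq) iSup_charSpace).1 χ).symm

theorem lWeightSpace_eq_bot [FiniteDimensional ℂ V] (R : Realization A H)
    (hq : NotRootOfUnity τ) (hV : IsDiagonalizable I H V τ) {Γ : LWeight R τ}
    (hΓ : Γ ∉ Set.range (charLWeight R hq hV)) : lWeightSpace V Γ = ⊥ :=
  (eq_of_le_of_iSupIndep (charLWeight_injective R hq hV) (charSpace_le_lWeightSpace R hq hV)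
    (iSupIndep_lWeightSpace R hq) iSup_charSpace).2 Γ hΓ

end Decomposition

/-! ### Traces over a module in terms of characters -/

section TraceFormula

open Module.End

variable {I : Type*} [Fintype I] {A : CartanDatum I} {H : Type*} [AddCommGroup H] [Module ℚ H]
variable {V : Type*} [AddCommGroup V] [Module ℂ V] [Module (Uq I H) V] [IsScalarTower ℂ (Uq I H) V]
variable {τ : ℂ}

/-- The character of the symmetric algebra given by a weight and a character of `U_q(ĥ)`. -/
def symChar (lam : Module.Dual ℚ H) (χ : Uq I H →ₐ[ℂ] ℂ) : SymH I H →ₐ[ℂ] ℂ :=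
  SymmetricAlgebra.lift (LinearMap.coprod (extWeight lam)
    (Finsupp.linearCombination ℂ fun p : I × {m : ℤ // m ≠ 0} => χ (Uq.h H p.1 p.2)))

theorem symChar_ι (lam : Module.Dual ℚ H) (χ : Uq I H →ₐ[ℂ] ℂ)
    (x : (ℂ ⊗[ℚ] H) × ((I × {m : ℤ // m ≠ 0}) →₀ ℂ)) :
    symChar lam χ (SymmetricAlgebra.ι ℂ _ x) = extWeight lam x.1 +
      χ (Finsupp.linearCombination ℂ
        (fun p : I × {m : ℤ // m ≠ 0} => Uq.h H p.1 (p.2 : ℤ)) x.2) := by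
  rw [symChar, SymmetricAlgebra.lift_ι_apply, LinearMap.coprod_apply]
  simp only [Finsupp.linearCombination_apply, Finsupp.sum, map_sum, map_smul]

theorem symChar_el (lam : Module.Dual ℚ H) (χ : Uq I H →ₐ[ℂ] ℂ) (w : H) :
    symChar lam χ (el I w) = (lam w : ℂ) := by
  rw [el, symChar_ι]
  simp [extWeight]

theorem symChar_hel (lam : Module.Dual ℚ H) (χ : Uq I H →ₐ[ℂ] ℂ) (i : I) (m : ℤ) :
    symChar lam χ (hel H i m) = χ (Uq.h H i m) := by
  unfold hel
  split_ifs with hm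
  · rw [symChar_ι]
    simp
  · simp [Uq.h, hm]

theorem genOp_apply (hV : IsDiagonalizable I H V τ)
    (x : (ℂ ⊗[ℚ] H) × ((I × {m : ℤ // m ≠ 0}) →₀ ℂ)) :
    genOp hV x = cartanOp hV x.1 + act V (Finsupp.linearCombination ℂ
        (fun p : I × {m : ℤ // m ≠ 0} => Uq.h H p.1 (p.2 : ℤ)) x.2) := by
  simp only [genOp, LinearMap.coprod_apply, LinearMap.coe_mk, AddHom.coe_mk,
    Finsupp.linearCombination_apply, Finsupp.sum, map_sum, map_smul]

theorem commute_cartanOp_act (hV : IsDiagonalizable I H V τ) (w : ℂ ⊗[ℚ] H) (u : Uq I H) :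
    Commute (cartanOp hV w) (act V u) := by
  refine end_ext hV fun lam v hv => ?_
  have h1 : act V u v ∈ weightSpace I V τ lam := by
    intro w'
    change Uq.k I w' • u • v = _ • u • v
    rw [← mul_smul, (Uq.commute _ _).eq, mul_smul, hv w', smul_comm]
  rw [Module.End.mul_apply, Module.End.mul_apply, cartanOp_apply hV w hv, map_smul,
    cartanOp_apply hV w h1]

theorem commute_piV_act (hV : IsDiagonalizable I H V τ) (x : SymH I H) (u : Uq I H) :
    Commute (act V u) (piV hV x) := by
  induction x using SymmetricAlgebra.induction with
  | algebraMap c => rw [AlgHom.commutes]; exact Algebra.commute_algebraMap_right c _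
  | ι x =>
    rw [piV_ι, genOp_apply]
    exact (commute_cartanOp_act hV _ u).symm.add_right (act_commute V _ _)
  | mul a b ha hb => rw [map_mul]; exact ha.mul_right hb
  | add a b ha hb => rw [map_add]; exact ha.add_right hb

/-- Both sides are compatible with sums and products, so generators suffice; there the $\mathfrak
h$-part acts by an honest scalar and the $h_{i,m}$ through `χ`. -/
theorem mem_maxGenEigenspace_piV (hq : NotRootOfUnity τ) (hV : IsDiagonalizable I H V τ)
    (χ : Chars I H V) {v : V} (hv : v ∈ charSpace V χ.1) (x : SymH I H) :
    v ∈ (piV hV x).maxGenEigenspace (symChar (charWeight hq hV χ) χ.1 x) := by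
  induction x using SymmetricAlgebra.induction with
  | algebraMap c =>
    rw [AlgHom.commutes, AlgHom.commutes]
    exact mem_maxGenEigenspace_algebraMap c v
  | ι x =>
    rw [piV_ι, genOp_apply, symChar_ι]
    refine mem_maxGenEigenspace_add (commute_cartanOp_act hV _ _) ?_ (mem_charSpace.1 hv _)
    rw [mem_maxGenEigenspace]
    refine ⟨1, ?_⟩
    rw [pow_one, LinearMap.sub_apply,
      cartanOp_apply hV _ (charSpace_le_weightSpace hq hV χ hv)]
    simp
  | mul a b ha hb =>
    rw [map_mul, map_mul]
    exact mem_maxGenEigenspace_mul ((Commute.all a b).map (piV hV)) ha hb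
  | add a b ha hb =>
    rw [map_add, map_add]
    exact mem_maxGenEigenspace_add ((Commute.all a b).map (piV hV)) ha hb

variable [FiniteDimensional ℂ V]

instance : Fintype (Chars I H V) := Fintype.ofFinite _

theorem trace_piV (hq : NotRootOfUnity τ) (hV : IsDiagonalizable I H V τ) (x : SymH I H) :
    LinearMap.trace ℂ V (piV hV x) = ∑ χ : Chars I H V,
      (Module.finrank ℂ (charSpace V χ.1) : ℂ) * symChar (charWeight hq hV χ) χ.1 x := by
  classical
  exact trace_eq_sum_of_le_maxGenEigenspace (isInternal_charSpace (I := I) (H := H) (V := V))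
    (fun χ => mapsTo_charSpace (commute_piV_act hV x) χ.1)
    fun χ v hv => mem_maxGenEigenspace_piV hq hV χ hv x

/-- `θ ⊗ id`, for a character `θ` of the symmetric algebra. -/
def charId (θ : SymH I H →ₐ[ℂ] ℂ) : SymH I H ⊗[ℂ] SymH I H →ₐ[ℂ] SymH I H :=
  Algebra.TensorProduct.lift ((Algebra.ofId ℂ (SymH I H)).comp θ) (AlgHom.id ℂ (SymH I H))
    fun _ _ => Commute.all _ _

theorem charId_tmul (θ : SymH I H →ₐ[ℂ] ℂ) (x y : SymH I H) :
    charId θ (x ⊗ₜ[ℂ] y) = θ x • y := by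
  rw [charId, Algebra.TensorProduct.lift_tmul, Algebra.smul_def]
  rfl

/-- The trace is not multiplicative, but this writes the partial trace as a sum of ring morphisms,
each of which can be moved inside products and exponentials. -/
theorem traceId_eq_sum (hq : NotRootOfUnity τ) (hV : IsDiagonalizable I H V τ) (F : Uh2 I H) :
    traceId hV F = ∑ χ : Chars I H V, Module.finrank ℂ (charSpace V χ.1) •
      PowerSeries.map (charId (symChar (charWeight hq hV χ) χ.1) :
        SymH I H ⊗[ℂ] SymH I H →+* SymH I H) F := by
  ext n
  simp only [traceId, PowerSeries.coeff_mk, map_sum, map_nsmul, PowerSeries.coeff_map]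
  induction PowerSeries.coeff n F using TensorProduct.induction_on with
  | zero => simp
  | add a b ha hb =>
    rw [map_add, map_add, ha, hb, ← Finset.sum_add_distrib]
    exact Finset.sum_congr rfl fun χ _ => by rw [map_add, smul_add]
  | tmul x y =>
    rw [TensorProduct.map_tmul, TensorProduct.lid_tmul, LinearMap.comp_apply,
      AlgHom.toLinearMap_apply, trace_piV hq, Finset.sum_smul]
    refine Finset.sum_congr rfl fun χ _ => ?_
    rw [RingHom.coe_coe, charId_tmul, mul_smul, Nat.cast_smul_eq_nsmul]
    rfl

end TraceFormula

/-! ### The `q`-character as a sum over characters -/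

section QCharSum

variable {I : Type*} [Fintype I] {A : CartanDatum I} {H : Type*} [AddCommGroup H] [Module ℚ H]
  [Module.Finite ℚ H] [DecidableEq I]
variable {V : Type*} [AddCommGroup V] [Module ℂ V] [Module (Uq I H) V] [IsScalarTower ℂ (Uq I H) V]
  [FiniteDimensional ℂ V]
variable {τ : ℂ}

theorem realize_single (R : Realization A H) (τ : ℂ) (m : Atilde R) (n : ℤ) :
    realize R τ (AddMonoidAlgebra.single m n) = n • realizeMonomial R τ m := by
  unfold realize
  exact Finsupp.sum_single_index (zero_smul _ _)

theorem realize_sum (R : Realization A H) (τ : ℂ) {X : Type*} (s : Finset X)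
    (f : X → AddMonoidAlgebra ℤ (Atilde R)) :
    realize R τ (∑ x ∈ s, f x) = ∑ x ∈ s, realize R τ (f x) := by
  classical
  induction s using Finset.induction_on with
  | empty =>
    rw [Finset.sum_empty, Finset.sum_empty]
    exact Finsupp.sum_zero_index
  | insert x s hx ih =>
    rw [Finset.sum_insert hx, Finset.sum_insert hx, ← ih]
    exact Finsupp.sum_add_index' (fun _ => zero_smul _ _) fun _ _ _ => add_smul _ _ _

theorem isRational_charLWeight (R : Realization A H) (hq : NotRootOfUnity τ)
    (hV : IsDiagonalizable I H V τ)
    (hrat : ∀ Γ : LWeight R τ, lWeightSpace V Γ ≠ ⊥ → Γ.IsRational) (χ : Chars I H V) :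
    (charLWeight R hq hV χ).IsRational :=
  hrat _ (by rw [lWeightSpace_charLWeight]; exact χ.2)

/-- The `finsum` is supported on the finite, injective image of the characters of `V`; elsewhere the
$l$-weight space vanishes. -/
theorem qChar_eq_sum (R : Realization A H) (hq : NotRootOfUnity τ)
    (hV : IsDiagonalizable I H V τ)
    (hrat : ∀ Γ : LWeight R τ, lWeightSpace V Γ ≠ ⊥ → Γ.IsRational) :
    qChar R hq V = ∑ χ : Chars I H V, AddMonoidAlgebra.single
      (monomial hq ⟨_, isRational_charLWeight R hq hV hrat χ⟩)
      (Module.finrank ℂ (charSpace V χ.1) : ℤ) := by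
  classical
  set g : Chars I H V → {Γ : LWeight R τ // Γ.IsRational} := fun χ =>
    ⟨_, isRational_charLWeight R hq hV hrat χ⟩
  have hginj : Function.Injective g := fun χ χ' h =>
    charLWeight_injective R hq hV (congrArg Subtype.val h)
  rw [qChar, finsum_eq_sum_of_support_subset (s := Finset.univ.image g), Finset.sum_image]
  · refine Finset.sum_congr rfl fun χ _ => ?_
    have h1 : Module.finrank ℂ (lWeightSpace V (charLWeight R hq hV χ)) =
        Module.finrank ℂ (charSpace V χ.1) := by rw [lWeightSpace_charLWeight]
    exact congrArg (fun n : ℕ => AddMonoidAlgebra.single (monomial hq (g χ)) (n : ℤ)) h1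
  · exact fun _ _ _ _ h => hginj h
  · intro Γ hΓ
    by_contra h
    refine hΓ ?_
    have h1 : Γ.1 ∉ Set.range (charLWeight R hq hV) := by
      rintro ⟨χ, hχ⟩
      exact h (by simpa using ⟨χ.1, χ.2, Subtype.ext hχ⟩)
    have h2 : Module.finrank ℂ (lWeightSpace V Γ.1) = 0 := by
      rw [lWeightSpace_eq_bot R hq hV h1, finrank_bot]
    simp only [h2, Nat.cast_zero, AddMonoidAlgebra.single_zero]

end QCharSum

/-! ### Quantized Cartan matrices -/

theorem qpow_neg (τ : ℂ) (x : ℚ) : qpow τ (-x) = (qpow τ x)⁻¹ := by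
  unfold qpow
  rw [← Complex.exp_neg]
  push_cast
  ring_nf

theorem qpow_mul_natCast (τ : ℂ) (x : ℚ) (m : ℕ) : qpow τ (x * m) = qpow τ x ^ m := by
  unfold qpow
  rw [← Complex.exp_nat_mul]
  push_cast
  ring_nf

theorem qint_inv (z : ℂ) (l : ℤ) : qint z⁻¹ l = qint z l := by
  unfold qint
  rw [inv_inv, inv_zpow', inv_zpow', neg_neg, ← neg_sub (z ^ l), ← neg_sub z, neg_div_neg_eq]

/-- `[l]_{q^m} = (q^{lm} - q^{-lm}) / (q^m - q^{-m})`. -/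
theorem qint_qpow (τ : ℂ) (m l : ℕ) : qint (qpow τ m) l =
    (qpow τ l ^ m - (qpow τ l)⁻¹ ^ m) / (qpow τ m - (qpow τ m)⁻¹) := by
  unfold qint
  rw [zpow_neg, zpow_natCast, ← qpow_mul_natCast, inv_pow, ← qpow_mul_natCast,
    mul_comm (m : ℚ) (l : ℚ)]

theorem qpow_sub_inv_ne_zero {τ : ℂ} (hq : NotRootOfUnity τ) {x : ℚ} (hx : x ≠ 0) :
    qpow τ x - (qpow τ x)⁻¹ ≠ 0 := by
  intro h
  rw [← qpow_neg] at h
  have := qpow_injective hq (sub_eq_zero.1 h)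
  exact hx (by linarith)

theorem qint_qpow_ne_zero {τ : ℂ} (hq : NotRootOfUnity τ) {m l : ℕ} (hm : m ≠ 0) (hl : l ≠ 0) :
    qint (qpow τ m) l ≠ 0 := by
  rw [qint_qpow]
  refine div_ne_zero ?_ (qpow_sub_inv_ne_zero hq (by exact_mod_cast hm))
  rw [inv_pow, ← qpow_mul_natCast]
  exact qpow_sub_inv_ne_zero hq (by exact_mod_cast mul_ne_zero hl hm)

section Cartan

variable {I : Type*} [DecidableEq I] (A : CartanDatum I)

theorem CartanDatum.Cz_inv (z : ℂ) : A.Cz z⁻¹ = A.Cz z := by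
  ext i j
  unfold CartanDatum.Cz
  rw [qint_inv, inv_pow, inv_inv, add_comm ((z ^ A.r i)⁻¹)]

variable [Fintype I]

/-- `D(z) B̃(z) = C̃(z)ᵀ`. -/
theorem CartanDatum.qint_mul_Btilde {z : ℂ} (hz : ∀ i, qint z (A.r i) ≠ 0) (i j : I) :
    qint z (A.r i) * A.Btilde z i j = A.Ctilde z j i := by
  have h1 : IsUnit (A.Dz z).det := by
    rw [CartanDatum.Dz, Matrix.det_diagonal]
    exact (Finset.prod_ne_zero_iff.2 fun i _ => hz i).isUnit
  -- From $B=C^TD$ one gets $B^{-1}=D^{-1}(C^T)^{-1}$, and the left factor $D$ cancels.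
  have h2 : A.Dz z * A.Btilde z = (A.Ctilde z).transpose := by
    rw [CartanDatum.Btilde, CartanDatum.Bz, Matrix.mul_inv_rev, ← mul_assoc,
      Matrix.mul_nonsing_inv _ h1, one_mul, CartanDatum.Ctilde, Matrix.transpose_nonsing_inv]
  have h3 := congrFun (congrFun h2 i) j
  rwa [CartanDatum.Dz, Matrix.diagonal_mul, Matrix.transpose_apply] at h3

end Cartan

/-! ### Evaluation of a character on the universal element -/

section Evaluation

variable {I : Type*} [Fintype I] {A : CartanDatum I} {H : Type*} [AddCommGroup H] [Module ℚ H]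
variable {V : Type*} [AddCommGroup V] [Module ℂ V] [Module (Uq I H) V] [IsScalarTower ℂ (Uq I H) V]
variable {τ : ℂ}

theorem el_smul (c : ℚ) (w : H) : el I (c • w) = (c : ℂ) • el I w := by
  unfold el
  rw [← map_smul, Prod.smul_mk, smul_zero, TensorProduct.tmul_smul, Rat.cast_smul_eq_qsmul]

theorem el_neg (w : H) : el I (-w) = -el I w := by
  simpa using el_smul (I := I) (-1) w

theorem el_sum {X : Type*} (s : Finset X) (w : X → H) :
    el I (∑ x ∈ s, w x) = ∑ x ∈ s, el I (w x) := by
  classical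
  have h1 : ∀ w : H, el I w = SymmetricAlgebra.ι ℂ _ (LinearMap.inl ℂ _ _ ((1 : ℂ) ⊗ₜ[ℚ] w)) :=
    fun _ => rfl
  simp only [h1, TensorProduct.tmul_sum, map_sum]

/-- The eigenvalue of `h_{i,m}`, `m > 0`, in terms of the polynomials attached to an
`l`-weight. -/
theorem char_h (R : Realization A H) (hq : NotRootOfUnity τ) (hV : IsDiagonalizable I H V τ)
    (χ : Chars I H V) {Q P : I → ℂ[X]} (h : (charLWeight R hq hV χ).IsPair Q P) (i : I) {m : ℕ}
    (hm : m ≠ 0) :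
    (qpow τ 1 - qpow τ (-1)) * χ.1 (Uq.h H i m) =
      (qpow τ (A.r i) ^ m - (qpow τ (A.r i))⁻¹ ^ m) *
        powerSum (factorExp (Q i) - factorExp (P i)) m / m := by
  obtain ⟨hQ, hP, h1, -⟩ := h i
  rw [mk_Psi_charLWeight] at h1
  set c := qpow τ (A.r i) ^ (((Q i).natDegree : ℤ) - ((P i).natDegree : ℤ))
  have hcoeff : ∀ (S : ℂ[X]) (d : ℂ), S.coeff 0 = 1 → PowerSeries.constantCoeff
      ((S.comp (Polynomial.C d * Polynomial.X) : ℂ[X]) : ℂ⟦X⟧) = 1 := fun S d hS => by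
    rw [coe_comp_C_mul_X_eq_pexp hS, constantCoeff_pexp]
  -- Constant terms identify the prefactors on the two sides, which then cancel and leave an
  -- equation between exponentials.
  have h2 : (charLWeight R hq hV χ).Psi 1 i 0 = c := by
    have := congrArg PowerSeries.constantCoeff h1
    simpa only [map_mul, Polynomial.coe_mul, constantCoeff_pexp, PowerSeries.constantCoeff_C,
      hcoeff _ _ hQ, hcoeff _ _ hP, mul_one] using this
  have hc : IsUnit (PowerSeries.C c) :=
    (IsUnit.mk0 _ (zpow_ne_zero _ (Complex.exp_ne_zero _))).map PowerSeries.C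
  rw [h2, mul_assoc] at h1
  have h3 := eq_of_pexp_mul_eq hQ hP (hc.mul_left_cancel h1) hm
  simpa using h3

variable [DecidableEq I]

theorem charId_htilde_term (R : Realization A H) (hq : NotRootOfUnity τ)
    (hV : IsDiagonalizable I H V τ) (χ : Chars I H V) {Q P : I → ℂ[X]}
    (h : (charLWeight R hq hV χ).IsPair Q P) {m : ℕ} (hm : m ≠ 0) :
    charId (symChar (charWeight hq hV χ) χ.1)
      ((-(qpow τ 1 - qpow τ (-1))) • ∑ i : I, ∑ j : I,
        ((m : ℂ) / qint (qpow τ 1) m * A.Btilde (qpow τ m) i j) •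
          (hel H i m ⊗ₜ[ℂ] hel H j (-(m : ℤ)))) =
      ∑ i, (-(qpow τ 1 - qpow τ (-1)) * powerSum (factorExp (Q i) - factorExp (P i)) m) •
        htilde A H τ i (-(m : ℤ)) := by
  rw [map_smul, map_sum, Finset.smul_sum]
  refine Finset.sum_congr rfl fun i _ => ?_
  rw [map_sum, htilde, Finset.smul_sum, Finset.smul_sum]
  refine Finset.sum_congr rfl fun j _ => ?_
  rw [map_smul, charId_tmul, symChar_hel, smul_smul, smul_smul, smul_smul]
  congr 1
  -- $\tilde h_{i,-m}$ is built from $\tilde C(q^{-m})$, whereas $\mathcal R^0$ involves $q^m$; the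
  -- symmetry $C(z^{-1})=C(z)$ reconciles them.
  have h1 : A.Ctilde (qpow τ ((-(m : ℤ) : ℤ) : ℚ)) = A.Ctilde (qpow τ m) := by
    unfold CartanDatum.Ctilde
    rw [Int.cast_neg, qpow_neg, CartanDatum.Cz_inv, Int.cast_natCast]
  have hr : ∀ i, qint (qpow τ m) (A.r i) ≠ 0 := fun i =>
    qint_qpow_ne_zero hq hm (A.r_pos i).ne'
  rw [h1, ← A.qint_mul_Btilde hr i j]
  have h2 := char_h R hq hV χ h i hm
  have hm' : (m : ℂ) ≠ 0 := by exact_mod_cast hm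
  have h3 : qpow τ m - (qpow τ m)⁻¹ ≠ 0 := qpow_sub_inv_ne_zero hq (by exact_mod_cast hm)
  have h4 : qpow τ 1 - (qpow τ 1)⁻¹ ≠ 0 := qpow_sub_inv_ne_zero hq one_ne_zero
  have h5 : qint (qpow τ 1) m = (qpow τ m - (qpow τ m)⁻¹) / (qpow τ 1 - (qpow τ 1)⁻¹) := by
    have := qint_qpow τ 1 m
    simpa using this
  rw [qpow_neg] at h2
  have h6 : χ.1 (Uq.h H i (m : ℤ)) = (qpow τ (A.r i) ^ m - (qpow τ (A.r i))⁻¹ ^ m) *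
      powerSum (factorExp (Q i) - factorExp (P i)) m / m / (qpow τ 1 - (qpow τ 1)⁻¹) := by
    rw [← h2, mul_div_cancel_left₀ _ h4]
  rw [h5, h6, qint_qpow]
  -- In these terms $[m]_q=y/w$ and $[r_i]_{q^m}=x/y$, and the claim is an identity of fractions.
  set x := qpow τ (A.r i) ^ m - (qpow τ (A.r i))⁻¹ ^ m
  set y := qpow τ m - (qpow τ m)⁻¹
  set w := qpow τ 1 - (qpow τ 1)⁻¹
  field_simp

theorem map_charId_R0 (R : Realization A H) (hq : NotRootOfUnity τ)
    (hV : IsDiagonalizable I H V τ) (χ : Chars I H V) {Q P : I → ℂ[X]}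
    (h : (charLWeight R hq hV χ).IsPair Q P) :
    PowerSeries.map (charId (symChar (charWeight hq hV χ) χ.1) :
      SymH I H ⊗[ℂ] SymH I H →+* SymH I H) (R0 A H τ) =
    pexp (posSeries fun m => ∑ i, (-(qpow τ 1 - qpow τ (-1)) *
      powerSum (factorExp (Q i) - factorExp (P i)) m) • htilde A H τ i (-(m : ℤ))) := by
  rw [R0, map_pexp, map_posSeries]
  congr 1
  exact posSeries_congr fun m hm => charId_htilde_term R hq hV χ h hm

/-- The exponents of a monomial enter its realization only through their power sums, the same data
that `char_h` extracts from an $l$-weight. -/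
theorem prod_Yexp_eq (τ : ℂ) (i : I) (u : ℂˣ →₀ ℤ) :
    (u.prod fun a n => (((isUnit_Yexp (A := A) (H := H) τ i a).unit ^ n : (Uh I H)ˣ) : Uh I H)) =
      pexp (posSeries fun m => (-(qpow τ 1 - qpow τ (-1)) * powerSum u m) •
        htilde A H τ i (-(m : ℤ))) := by
  have h1 : ∀ (a : ℂˣ) (n : ℤ), (((isUnit_Yexp (A := A) (H := H) τ i a).unit ^ n : (Uh I H)ˣ) : Uh I H) =
      pexp (n • posSeries fun m =>
        (-(qpow τ 1 - qpow τ (-1)) * (a : ℂ) ^ m) • htilde A H τ i (-(m : ℤ))) := fun a n =>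
    unit_zpow_eq_pexp (constantCoeff_posSeries _) _ n
  rw [Finsupp.prod, Finset.prod_congr rfl fun a _ => h1 a (u a), ← pexp_sum]
  · congr 1
    ext m
    rw [map_sum]
    by_cases hm : m = 0
    · simp [posSeries, hm]
    · simp only [map_zsmul, coeff_posSeries _ hm]
      rw [powerSum, Finsupp.sum, Finset.mul_sum, Finset.sum_smul]
      refine Finset.sum_congr rfl fun a _ => ?_
      rw [← Int.cast_smul_eq_zsmul ℂ, smul_smul]
      ring_nf
  · intro a _
    rw [map_zsmul, constantCoeff_posSeries, smul_zero]

variable [Module.Finite ℚ H]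

theorem map_charId_T (R : Realization A H) {X : Type*} [Fintype X] (Lam : Module.Basis X ℚ H)
    (lam : Module.Dual ℚ H) (χ : Uq I H →ₐ[ℂ] ℂ) :
    PowerSeries.map (charId (symChar lam χ) : SymH I H ⊗[ℂ] SymH I H →+* SymH I H) (T R Lam) =
      kh I (-R.nu lam) := by
  classical
  -- Pairing the first tensor factor of $\sum_x\Lambda_x^\vee\otimes\nu(\alpha_x)$ with $\lambda$
  -- gives $\nu$ of this expansion.
  have hlam : lam = ∑ x, lam (Lam x) • Lam.coord x := by
    refine Lam.ext fun x => ?_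
    rw [LinearMap.sum_apply, Finset.sum_eq_single x]
    · simp
    · intro y _ hy
      simp [hy.symm]
    · simp
  have hnu : el I (R.nu lam) = ∑ x, (lam (Lam x) : ℂ) • el I (R.nu (Lam.coord x)) := by
    conv_lhs => rw [hlam]
    rw [map_sum, el_sum]
    exact Finset.sum_congr rfl fun x _ => by rw [map_smul, el_smul]
  rw [T, map_pexp, kh, el_neg, hnu, map_neg, map_mul, PowerSeries.map_C, PowerSeries.map_X,
    map_neg, neg_mul]
  congr 4
  rw [RingHom.coe_coe, map_sum]
  refine Finset.sum_congr rfl fun x _ => ?_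
  rw [charId_tmul, symChar_el]

theorem map_charId_R0_mul_T (R : Realization A H) (hq : NotRootOfUnity τ)
    (hV : IsDiagonalizable I H V τ) {X : Type*} [Fintype X] (Lam : Module.Basis X ℚ H)
    (χ : Chars I H V) (h : (charLWeight R hq hV χ).IsRational) :
    PowerSeries.map (charId (symChar (charWeight hq hV χ) χ.1) :
      SymH I H ⊗[ℂ] SymH I H →+* SymH I H) (R0 A H τ * T R Lam) =
    realizeMonomial R τ (monomial hq ⟨_, h⟩) := by
  -- The polynomials used for $\mathcal R^0$ are the ones chosen from `h` inside `monomial`, so the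
  -- two exponents agree without comparing different choices.
  rw [map_mul, map_charId_R0 R hq hV χ h.choose_spec.choose_spec, map_charId_T, realizeMonomial,
    mul_comm]
  congr 1
  simp only [prod_Yexp_eq]
  rw [← pexp_sum _ fun i _ => constantCoeff_posSeries _]
  congr 1
  ext m
  rw [map_sum]
  by_cases hm : m = 0
  · simp [posSeries, hm]
  · simp only [coeff_posSeries _ hm]
    rfl

end Evaluation

end QAff

end

theorem mainTheorem10 {I : Type*} [Fintype I] [DecidableEq I] (A : QAff.CartanDatum I)
    {H : Type*} [AddCommGroup H] [Module ℚ H] [Module.Finite ℚ H] (R : QAff.Realization A H)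
    (τ : ℂ) (hq : QAff.NotRootOfUnity τ)
    (hC : ∀ m : ℕ, 1 ≤ m → IsUnit (A.Cz (QAff.qpow τ m)).det)
    {K : Type*} [Fintype K] (Lam : Module.Basis (I ⊕ K) ℚ H)
    (hLam : ∀ i : I, Lam.coord (Sum.inl i) = R.root i)
    (V : Type*) [AddCommGroup V] [Module ℂ V] [FiniteDimensional ℂ V]
    [Module (QAff.Uq I H) V] [IsScalarTower ℂ (QAff.Uq I H) V]
    (hV : QAff.IsDiagonalizable I H V τ)
    (hrat : ∀ Γ : QAff.LWeight R τ, QAff.lWeightSpace V Γ ≠ ⊥ → Γ.IsRational) :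
    QAff.traceId hV (QAff.R0 A H τ * QAff.T R Lam) =
      QAff.realize R τ (QAff.qChar R hq V) := by
  rw [QAff.traceId_eq_sum hq, QAff.qChar_eq_sum R hq hV hrat, QAff.realize_sum]
  refine Finset.sum_congr rfl fun χ _ => ?_
  rw [QAff.realize_single, QAff.map_charId_R0_mul_T R hq hV Lam χ
    (QAff.isRational_charLWeight R hq hV hrat χ), natCast_zsmul]
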